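/- Let $\Phi$ be a unital quantum channel on $n$ qubits, i.e. a completely positive trace preserving linear map on $2^n\times 2^n$ complex matrices with $\Phi(\mathbb I)=\mathbb I$. Its Choi state is $\tau=(\Phi\otimes\mathrm{id})(|\Omega\rangle\langle\Omega|)$, where $|\Omega\rangle=2^{-n/2}\sum_i|i\,i\rangle$, and $S(\tau)=-\operatorname{Tr}[\tau\log_2\tau]$ is its von Neumann entropy. For unitaries $U_1,\dots,U_D\in U(2^n)$, with $\mathcal U_i(X)=U_iXU_i^\dagger$, consider the noisy circuit $$\mathcal E=\Phi\circ\mathcal U_D\circ\Phi\circ\cdots\circ\Phi\circ\mathcal U_2\circ\Phi\circ\mathcal U_1 .$$ A unitary 1-design is a probability measure on $U(2^n)$ under which every polynomial that is homogeneous of degree $1$ in the entries of $U$ and homogeneous of degree $1$ in their complex conjugates has the same expectation as under the Haar measure. A state 1-design is the law of $U|\phi_0\rangle$, with $|\phi_0\rangle$ a fixed unit vector and $U$ distributed according to a unitary 1-design. Let $|\psi\rangle,|\phi\rangle,U_1,\dots,U_D$ be independent, where $|\psi\rangle$ and $|\phi\rangle$ are each distributed according to a (possibly different) state 1-design and every $U_i$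 according to a (possibly different) unitary 1-design. With $\|\cdot\|_1$ the trace norm (the sum of the singular values), put $$\bar\eta=\mathbb E_{\psi,\phi,U_1,\dots,U_D}\left[\frac{\big\|\mathcal E(|\psi\rangle\langle\psi|)-\mathcal E(|\phi\rangle\langle\phi|)\big\|_1}{\big\||\psi\rangle\langle\psi|-|\phi\rangle\langle\phi|\big\|_1}\right],$$ where the ratio is set to $0$, its least possible value, when $|\psi\rangle\langle\psi|=|\phi\rangle\langle\phi|$. **(1)** For all $\varepsilon\in(0,1)$, $\delta>0$ and $K\in\mathbb N$ there is a $D_0$, depending only on $\varepsilon$, $\delta$ and $K$ (in particular not on $n$), such that for every $n$, every unital $n$-qubit channel $\Phi$ whose Choi state has rank at most $K$ (equivalently, which has a Kraus decomposition with at most $K$ operators), every $D\ge D_0$ and all 1-designs as above, $$\bar\eta\;\ge\;1-\varepsilon-2^{D(S(\tau)+\delta)-n}.$$ **(2)** Let $\varphi$ be a unital single-qubit channel with Choi state $\tau_1$, and let the depth $D$ be fixed with $D\,S(\tau_1)<1$ (that is, $D<1/S(\tau_1)$, with no restriction on $D$ if $S(\tau_1)=0$). For every $n$ let $\Phi=\varphi^{\otimes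 n}$, and choose arbitrary state and unitary 1-designs on $n$ qubits as above. Then $\bar\eta\to1$ as $n\to\infty$. -/

import Mathlib

open MeasureTheory Filter Topology Matrix
open scoped ComplexOrder

noncomputable section

/-- Labels of the computational basis of `n` qubits, so that `n`-qubit operators are
matrices of size `2 ^ n`. -/
abbrev Qubits (n : ℕ) : Type := Fin n → Fin 2

/-! ### Trace norm, channels, Choi state, entropy -/

/-- The trace norm (Schatten `1`-norm): the sum of the singular values, with multiplicity. -/
def traceNorm {ι : Type} [Fintype ι] [DecidableEq ι] (A : Matrix ι ι ℂ) : ℝ :=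
  ∑ k ∈ Finset.range (Fintype.card ι), (Matrix.toEuclideanLin A).singularValues k

/-- `T ⊗ id` on operators of a bipartite system: `T` is applied to each block
`(⟨i, a| M |j, b⟩)_{i, j}`. -/
def tensorId {ι : Type} (T : Matrix ι ι ℂ →ₗ[ℂ] Matrix ι ι ℂ) {κ : Type}
    (M : Matrix (ι × κ) (ι × κ) ℂ) : Matrix (ι × κ) (ι × κ) ℂ :=
  Matrix.of fun p q => T (Matrix.of fun i j => M (i, p.2) (j, q.2)) p.1 q.1

/-- Complete positivity: `T ⊗ id` is positive for every finite-dimensional ancilla. -/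
def IsCompletelyPositive {ι : Type} (T : Matrix ι ι ℂ →ₗ[ℂ] Matrix ι ι ℂ) : Prop :=
  ∀ (κ : Type) [Fintype κ] (M : Matrix (ι × κ) (ι × κ) ℂ),
    M.PosSemidef → (tensorId T M).PosSemidef

/-- A quantum channel: a completely positive and trace preserving linear map. -/
structure IsQuantumChannel {ι : Type} [Fintype ι] (T : Matrix ι ι ℂ →ₗ[ℂ] Matrix ι ι ℂ) :
    Prop where
  completelyPositive : IsCompletelyPositive T
  tracePreserving : ∀ A, (T A).trace = A.trace

/-- The channel fixes the identity. -/
def IsUnital {ι : Type} [DecidableEq ι] (T : Matrix ι ι ℂ →ₗ[ℂ] Matrix ι ι ℂ) : Prop :=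
  T 1 = 1

/-- The maximally entangled unit vector `d^{-1/2} ∑ i, |i i⟩`. -/
def maxEntangled (ι : Type) [Fintype ι] [DecidableEq ι] : ι × ι → ℂ :=
  fun p => if p.1 = p.2 then ((√(Fintype.card ι : ℝ) : ℝ) : ℂ)⁻¹ else 0

/-- The Choi state `(T ⊗ id)(|Ω⟩⟨Ω|)`. -/
def choiState {ι : Type} [Fintype ι] [DecidableEq ι] (T : Matrix ι ι ℂ →ₗ[ℂ] Matrix ι ι ℂ) :
    Matrix (ι × ι) (ι × ι) ℂ :=
  tensorId T (Matrix.vecMulVec (maxEntangled ι) (star (maxEntangled ι)))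

open Classical in
/-- The von Neumann entropy in bits, `S(ρ) = -∑ λ log₂ λ` over the eigenvalues of the
Hermitian matrix `ρ` (with `0 log 0 = 0`; the value at non-Hermitian matrices is irrelevant). -/
def vonNeumannEntropy {κ : Type} [Fintype κ] [DecidableEq κ] (ρ : Matrix κ κ ℂ) : ℝ :=
  if h : ρ.IsHermitian then -∑ i, h.eigenvalues i * Real.logb 2 (h.eigenvalues i) else 0

/-- The product channel `φ^{⊗ n}` of a single-qubit map `φ`: the linear map with
`|i₁…iₙ⟩⟨j₁…jₙ| ↦ ⨂ₛ φ(|iₛ⟩⟨jₛ|)`. -/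
def tensorPower (φ : Matrix (Fin 2) (Fin 2) ℂ →ₗ[ℂ] Matrix (Fin 2) (Fin 2) ℂ) (n : ℕ) :
    Matrix (Qubits n) (Qubits n) ℂ →ₗ[ℂ] Matrix (Qubits n) (Qubits n) ℂ where
  toFun M := Matrix.of fun a b =>
    ∑ i, ∑ j, M i j * ∏ s, φ (Matrix.single (i s) (j s) 1) (a s) (b s)
  map_add' M N := by
    ext a b
    simp [add_mul, Finset.sum_add_distrib]
  map_smul' c M := by
    ext a b
    simp [Finset.mul_sum, mul_assoc]

/-! ### Designs -/

instance {ι : Type} [Fintype ι] [DecidableEq ι] : MeasurableSpace (Matrix.unitaryGroup ι ℂ) :=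
  borel _

instance {ι : Type} [Fintype ι] [DecidableEq ι] : BorelSpace (Matrix.unitaryGroup ι ℂ) :=
  ⟨rfl⟩

instance {ι : Type} [Fintype ι] [DecidableEq ι] : CompactSpace (Matrix.unitaryGroup ι ℂ) := by
  refine isCompact_iff_compactSpace.mp ?_
  have hK : IsCompact (Set.univ.pi fun _ : ι => Set.univ.pi fun _ : ι =>
      Metric.closedBall (0 : ℂ) 1) :=
    isCompact_univ_pi fun _ => isCompact_univ_pi fun _ => isCompact_closedBall 0 1
  refine hK.of_isClosed_subset ?_ ?_
  · exact isClosed_unitary (R := Matrix ι ι ℂ)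
  · intro U hU i _ j _
    simpa using entry_norm_bound_of_unitary hU i j

/-- The normalized Haar measure on the unitary group. -/
def haarUnitary (ι : Type) [Fintype ι] [DecidableEq ι] : Measure (Matrix.unitaryGroup ι ℂ) :=
  Measure.haarMeasure ⊤

/-- The value at `U` of a polynomial in the entries of `U` (the variables `Sum.inl (i, j)`) and
in their complex conjugates (the variables `Sum.inr (i, j)`). -/
def evalUnitary {ι : Type} [Fintype ι] [DecidableEq ι]
    (p : MvPolynomial ((ι × ι) ⊕ (ι × ι)) ℂ) (U : Matrix.unitaryGroup ι ℂ) : ℂ :=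
  MvPolynomial.eval
    (Sum.elim (fun e => (U : Matrix ι ι ℂ) e.1 e.2) (fun e => star ((U : Matrix ι ι ℂ) e.1 e.2))) p

/-- `p` is homogeneous of degree `t` in the entries of `U` and homogeneous of degree `t` in
their conjugates. -/
def IsBihomogeneous {ι : Type} (t : ℕ) (p : MvPolynomial ((ι × ι) ⊕ (ι × ι)) ℂ) : Prop :=
  MvPolynomial.IsWeightedHomogeneous
    (Sum.elim (fun _ => ((1, 0) : ℕ × ℕ)) (fun _ => ((0, 1) : ℕ × ℕ))) p (t, t)

/-- A unitary `t`-design: a probability measure on the unitary group whose averages of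
polynomials of bidegree `(t, t)` are those of the Haar measure. -/
structure IsUnitaryDesign {ι : Type} [Fintype ι] [DecidableEq ι] (t : ℕ)
    (μ : Measure (Matrix.unitaryGroup ι ℂ)) : Prop where
  isProbabilityMeasure : IsProbabilityMeasure μ
  integral_eq : ∀ p : MvPolynomial ((ι × ι) ⊕ (ι × ι)) ℂ, IsBihomogeneous t p →
    ∫ U, evalUnitary p U ∂μ = ∫ U, evalUnitary p U ∂(haarUnitary ι)

/-- A state `t`-design: the law of `U |φ₀⟩` for a fixed unit vector `φ₀` and a unitary
`U` distributed according to a unitary `t`-design. -/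
def IsStateDesign {ι : Type} [Fintype ι] [DecidableEq ι] (t : ℕ)
    (ν : Measure (EuclideanSpace ℂ ι)) : Prop :=
  ∃ (φ₀ : EuclideanSpace ℂ ι) (μ : Measure (Matrix.unitaryGroup ι ℂ)),
    ‖φ₀‖ = 1 ∧ IsUnitaryDesign t μ ∧
      ν = μ.map fun U : Matrix.unitaryGroup ι ℂ =>
        Matrix.toEuclideanLin (U : Matrix ι ι ℂ) φ₀

/-! ### Noisy circuits and their average contraction -/

/-- The pure state `|ψ⟩⟨ψ|`. -/
def pureState {ι : Type} (ψ : EuclideanSpace ℂ ι) : Matrix ι ι ℂ :=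
  Matrix.of fun i j => ψ i * star (ψ j)

/-- Conjugation `A ↦ U A U†`. -/
def unitaryConj {ι : Type} [Fintype ι] [DecidableEq ι] (U : Matrix.unitaryGroup ι ℂ) :
    Matrix ι ι ℂ →ₗ[ℂ] Matrix ι ι ℂ where
  toFun A := (U : Matrix ι ι ℂ) * A * (U : Matrix ι ι ℂ)ᴴ
  map_add' A B := by simp [mul_add, add_mul]
  map_smul' c A := by simp

/-- The noisy circuit `Φ ∘ 𝒰_D ∘ ⋯ ∘ Φ ∘ 𝒰_2 ∘ Φ ∘ 𝒰_1`; the layer `𝒰_{k+1}` is conjugation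
by `U k`. -/
def noisyCircuit {ι : Type} [Fintype ι] [DecidableEq ι]
    (Φ : Matrix ι ι ℂ →ₗ[ℂ] Matrix ι ι ℂ) :
    (D : ℕ) → (Fin D → Matrix.unitaryGroup ι ℂ) → (Matrix ι ι ℂ →ₗ[ℂ] Matrix ι ι ℂ)
  | 0, _ => LinearMap.id
  | D + 1, U => Φ ∘ₗ unitaryConj (U (Fin.last D)) ∘ₗ noisyCircuit Φ D fun k => U k.castSucc

/-- The ratio `‖T(ψ) - T(φ)‖₁ / ‖ψ - φ‖₁` of trace distances for pure inputs. When the two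
states coincide it is `0`, the smallest value that could be assigned to the ratio. -/
def contractionRatio {ι : Type} [Fintype ι] [DecidableEq ι]
    (T : Matrix ι ι ℂ →ₗ[ℂ] Matrix ι ι ℂ) (ψ φ : EuclideanSpace ℂ ι) : ℝ :=
  traceNorm (T (pureState ψ) - T (pureState φ)) / traceNorm (pureState ψ - pureState φ)

/-- The expected ratio of trace distances of a noisy circuit of depth `D`, where the two inputs,
with laws `ν₁` and `ν₂`, and the layers, with laws `μ k`, are all independent. -/
def averageContraction {ι : Type} [Fintype ι] [DecidableEq ι]
    (Φ : Matrix ι ι ℂ →ₗ[ℂ] Matrix ι ι ℂ) (D : ℕ) (ν₁ ν₂ : Measure (EuclideanSpace ℂ ι))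
    (μ : Fin D → Measure (Matrix.unitaryGroup ι ℂ)) : ℝ :=
  ∫ ω : EuclideanSpace ℂ ι × EuclideanSpace ℂ ι × (Fin D → Matrix.unitaryGroup ι ℂ),
    contractionRatio (noisyCircuit Φ D ω.2.2) ω.1 ω.2.1 ∂(ν₁.prod (ν₂.prod (Measure.pi μ)))

end

/-! Two outputs are distinguished by a low-rank projection that knows one of them. Take Kraus
operators `K a` of the channel from the eigenvectors of its Choi state, so that `tr (K a (K a)†) /
d` is the eigenvalue `p a`, with `d` the dimension. Expanding every layer writes the circuit as a
sum over paths `α`, each sending `ψ` to a vector. Twirling a layer over a 1-design replaces the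
state before it by a multiple of the identity, so the average squared norm of the path vector is `∏
k, p (α k)` (`integral_trace_krausPath`): on average, paths are weighted like independent samples
from the spectrum of the Choi state.

For any set `G` of paths, let `P` project onto the span of the path vectors of `ψ` with `α ∈ G`. It
captures at least the weight of `G` in the output of `ψ`. It does not depend on `φ`, whose average
is maximally mixed, a state that the unital circuit fixes; hence the output of `φ` meets `P` with
average probability at most `|G| / d`. The denominator of the ratio is at most 2, so the average
contraction is at least the weight of `G` minus `|G| / d` (`le_averageContraction`).

Choosing `G` typical gives weight close to 1 and size about `2 ^ (N S)`, by Chebyshev's inequality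
for the surprisal (`le_sum_typicalSet`, `card_typicalSet_le`). For a general channel `N = D`, and
the variance is controlled by the Choi rank (`varentropy_le`). For a product channel the weights
factor over qubits as well, `N = D n`, and fixed depth suffices. -/

/-! ### Trace norm of Hermitian matrices: variational formula, contractivity, measurability. -/

section TraceNorm

variable {ι : Type} [Fintype ι] [DecidableEq ι]

lemma traceNorm_eq_sum_sqrt (A : Matrix ι ι ℂ) (hB : (Aᴴ * A).IsHermitian) :
    traceNorm A = ∑ i, √(hB.eigenvalues i) := by
  have hn : Module.finrank ℂ (EuclideanSpace ℂ ι) = Fintype.card ι := finrank_euclideanSpace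
  have hT : (LinearMap.adjoint (toEuclideanLin A)) ∘ₗ toEuclideanLin A =
      toEuclideanLin (Aᴴ * A) := by
    rw [← Matrix.toEuclideanLin_conjTranspose_eq_adjoint]
    ext v : 1
    simp [Matrix.toLpLin_apply, Matrix.mulVec_mulVec]
  have h1 : traceNorm A = ∑ i : Fin (Fintype.card ι), √(hB.eigenvalues₀ i) := by
    unfold traceNorm
    rw [Finset.sum_range]
    refine Finset.sum_congr rfl fun i _ => ?_
    rw [LinearMap.singularValues_fin (toEuclideanLin A) hn i]
    unfold Matrix.IsHermitian.eigenvalues₀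
    simp only [hT]
  rw [h1]
  exact (Equiv.sum_comp (Fintype.equivOfCardEq (Fintype.card_fin _)).symm
    (fun i => √(hB.eigenvalues₀ i))).symm

lemma Matrix.IsHermitian.eq_unitary_conj_diagonal {A : Matrix ι ι ℂ} (hA : A.IsHermitian) :
    A = (hA.eigenvectorUnitary : Matrix ι ι ℂ) * diagonal (fun i => (hA.eigenvalues i : ℂ)) *
      (hA.eigenvectorUnitary : Matrix ι ι ℂ)ᴴ := by
  have := hA.spectral_theorem
  rw [Unitary.conjStarAlgAut_apply] at this
  exact this

lemma Matrix.IsHermitian.traceNorm_eq {A : Matrix ι ι ℂ} (hA : A.IsHermitian) :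
    traceNorm A = ∑ i, |hA.eigenvalues i| := by
  have hB : (Aᴴ * A).IsHermitian := isHermitian_conjTranspose_mul_self A
  rw [traceNorm_eq_sum_sqrt A hB]
  set V : Matrix ι ι ℂ := (hA.eigenvectorUnitary : Matrix ι ι ℂ) with hV
  have hVV : Vᴴ * V = 1 := Unitary.coe_star_mul_self hA.eigenvectorUnitary
  have hA' := hA.eq_unitary_conj_diagonal
  rw [← hV] at hA'
  have h2 : Aᴴ * A = V * (diagonal (fun i => ((hA.eigenvalues i : ℂ)) ^ 2) * Vᴴ) := by
    rw [hA.eq]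
    calc A * A = (V * diagonal (fun i => (hA.eigenvalues i : ℂ)) * Vᴴ) *
          (V * diagonal (fun i => (hA.eigenvalues i : ℂ)) * Vᴴ) := by rw [← hA']
      _ = V * diagonal (fun i => (hA.eigenvalues i : ℂ)) * (Vᴴ * V) *
          diagonal (fun i => (hA.eigenvalues i : ℂ)) * Vᴴ := by simp only [Matrix.mul_assoc]
      _ = _ := by
        rw [hVV, Matrix.mul_one, Matrix.mul_assoc V, diagonal_mul_diagonal, Matrix.mul_assoc]
        simp only [sq]
  -- Comparing roots of characteristic polynomials yields equality of the spectra as multisets, so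
  -- the two enumerations of eigenvalues need not be matched.
  have h3 : (Aᴴ * A).charpoly.roots =
      Multiset.map (fun i => ((hA.eigenvalues i : ℂ)) ^ 2) Finset.univ.val := by
    rw [h2, charpoly_mul_comm, Matrix.mul_assoc, hVV, Matrix.mul_one, charpoly_diagonal,
      Polynomial.roots_prod]
    · simp only [Polynomial.roots_X_sub_C, Multiset.bind_singleton]
    · exact Finset.prod_ne_zero_iff.mpr fun i _ => Polynomial.X_sub_C_ne_zero _
  rw [hB.roots_charpoly_eq_eigenvalues] at h3
  have h4 := congrArg (fun s => (s.map fun z : ℂ => √z.re).sum) h3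
  simp only [Multiset.map_map, Function.comp_def] at h4
  have h5 : ∀ x : ℝ, (((x : ℂ)) ^ 2).re = x ^ 2 := fun x => by norm_cast
  simp only [h5, Real.sqrt_sq_eq_abs] at h4
  simpa using h4

/-- In an eigenbasis of `A` the trace is the sum of the eigenvalues weighted by diagonal entries of
a unitary, which have modulus at most 1. With `exists_unitary_re_trace_eq` this makes the trace norm
a maximum of linear functionals. -/
lemma re_trace_unitary_mul_le {A : Matrix ι ι ℂ} (hA : A.IsHermitian)
    {W : Matrix ι ι ℂ} (hW : W ∈ unitaryGroup ι ℂ) : (W * A).trace.re ≤ traceNorm A := by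
  rw [hA.traceNorm_eq]
  set V := hA.eigenvectorUnitary with hV
  have hmem : (V : Matrix ι ι ℂ)ᴴ * W * (V : Matrix ι ι ℂ) ∈ unitaryGroup ι ℂ :=
    mul_mem (mul_mem (star V).2 hW) V.2
  have h1 : (W * A).trace = ∑ i, ((V : Matrix ι ι ℂ)ᴴ * W * (V : Matrix ι ι ℂ)) i i *
      (hA.eigenvalues i : ℂ) := by
    conv_lhs => rw [hA.eq_unitary_conj_diagonal, ← Matrix.mul_assoc, trace_mul_comm,
      ← Matrix.mul_assoc, ← Matrix.mul_assoc]
    simp [trace, mul_diagonal, hV]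
  rw [h1, Complex.re_sum]
  refine Finset.sum_le_sum fun i _ => ?_
  refine (Complex.re_le_norm _).trans ?_
  rw [norm_mul, Complex.norm_real, Real.norm_eq_abs]
  exact mul_le_of_le_one_left (abs_nonneg _) (entry_norm_bound_of_unitary hmem i i)

lemma exists_unitary_re_trace_eq {A : Matrix ι ι ℂ} (hA : A.IsHermitian) :
    ∃ W ∈ unitaryGroup ι ℂ, (W * A).trace.re = traceNorm A := by
  set V := hA.eigenvectorUnitary with hV
  have hVV : (V : Matrix ι ι ℂ)ᴴ * (V : Matrix ι ι ℂ) = 1 := Unitary.coe_star_mul_self V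
  -- The maximizer is the sign of `A`, with value 1 on the kernel so that it stays unitary.
  let s : ι → ℂ := fun i => if 0 ≤ hA.eigenvalues i then 1 else -1
  have hs : diagonal s ∈ unitaryGroup ι ℂ := by
    rw [mem_unitaryGroup_iff, star_eq_conjTranspose, diagonal_conjTranspose, diagonal_mul_diagonal,
      ← diagonal_one]
    congr 1
    ext i
    simp only [s, Pi.star_apply]
    split_ifs <;> simp
  refine ⟨V * diagonal s * (V : Matrix ι ι ℂ)ᴴ, mul_mem (mul_mem V.2 hs) (star V).2, ?_⟩
  have h1 : (V * diagonal s * (V : Matrix ι ι ℂ)ᴴ * A).trace =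
      ∑ i, s i * (hA.eigenvalues i : ℂ) := by
    conv_lhs => rw [hA.eq_unitary_conj_diagonal, ← hV]
    rw [trace_mul_comm]
    calc _ = ((V : Matrix ι ι ℂ) * (diagonal (fun i => (hA.eigenvalues i : ℂ)) *
            ((V : Matrix ι ι ℂ)ᴴ * V) * diagonal s * (V : Matrix ι ι ℂ)ᴴ)).trace := by
          simp only [Matrix.mul_assoc]
      _ = _ := by
        rw [trace_mul_comm, hVV, Matrix.mul_one, Matrix.mul_assoc, hVV, Matrix.mul_one,
          diagonal_mul_diagonal]
        simp [trace, mul_comm]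
  rw [h1, hA.traceNorm_eq, Complex.re_sum]
  refine Finset.sum_congr rfl fun i _ => ?_
  simp only [s]
  split_ifs with h
  · simp [abs_of_nonneg h]
  · simp [abs_of_neg (not_le.mp h)]

lemma traceNorm_nonneg (A : Matrix ι ι ℂ) : 0 ≤ traceNorm A :=
  Finset.sum_nonneg fun _ _ => LinearMap.singularValues_nonneg _ _

lemma Matrix.PosSemidef.traceNorm_eq {A : Matrix ι ι ℂ} (hA : A.PosSemidef) :
    traceNorm A = A.trace.re := by
  rw [hA.1.traceNorm_eq, hA.1.trace_eq_sum_eigenvalues, Complex.re_sum]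
  exact Finset.sum_congr rfl fun i _ => by simp [abs_of_nonneg (hA.eigenvalues_nonneg i)]

lemma traceNorm_sub_le {A B : Matrix ι ι ℂ} (hA : A.PosSemidef) (hB : B.PosSemidef) :
    traceNorm (A - B) ≤ A.trace.re + B.trace.re := by
  obtain ⟨W, hW, h⟩ := exists_unitary_re_trace_eq (hA.1.sub hB.1)
  rw [← h, Matrix.mul_sub, trace_sub, Complex.sub_re]
  have h1 := re_trace_unitary_mul_le hA.1 hW
  have h2 := re_trace_unitary_mul_le hB.1 (W := -W) (by simpa [mem_unitaryGroup_iff] using hW)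
  rw [hA.traceNorm_eq] at h1
  rw [hB.traceNorm_eq, Matrix.neg_mul, trace_neg, Complex.neg_re] at h2
  linarith

/-- The Jordan decomposition of a Hermitian matrix into positive and negative part. -/
lemma exists_posSemidef_sub {A : Matrix ι ι ℂ} (hA : A.IsHermitian) :
    ∃ P N : Matrix ι ι ℂ, P.PosSemidef ∧ N.PosSemidef ∧ A = P - N ∧
      P.trace.re + N.trace.re = traceNorm A := by
  set V := hA.eigenvectorUnitary with hV
  have hVV : (V : Matrix ι ι ℂ)ᴴ * (V : Matrix ι ι ℂ) = 1 := Unitary.coe_star_mul_self V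
  have key : ∀ f : ι → ℝ, (∀ i, 0 ≤ f i) →
      ((V : Matrix ι ι ℂ) * diagonal (fun i => (f i : ℂ)) * (V : Matrix ι ι ℂ)ᴴ).PosSemidef ∧
      ((V : Matrix ι ι ℂ) * diagonal (fun i => (f i : ℂ)) * (V : Matrix ι ι ℂ)ᴴ).trace.re
        = ∑ i, f i := by
    intro f hf
    refine ⟨(PosSemidef.diagonal fun i => ?_).mul_mul_conjTranspose_same _, ?_⟩
    · simpa using hf i
    · rw [trace_mul_comm, ← Matrix.mul_assoc, hVV, Matrix.one_mul]
      simp [trace]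
  obtain ⟨p1, p2⟩ := key (fun i => (hA.eigenvalues i)⁺) fun i => posPart_nonneg _
  obtain ⟨n1, n2⟩ := key (fun i => (hA.eigenvalues i)⁻) fun i => negPart_nonneg _
  refine ⟨_, _, p1, n1, ?_, ?_⟩
  · conv_lhs => rw [hA.eq_unitary_conj_diagonal]
    rw [← Matrix.sub_mul, ← Matrix.mul_sub, diagonal_sub]
    congr! 4 with i
    rw [← Complex.ofReal_sub, posPart_sub_negPart]
  · rw [p2, n2, hA.traceNorm_eq, ← Finset.sum_add_distrib]
    exact Finset.sum_congr rfl fun i _ => posPart_add_negPart _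

/-- Positive trace preserving maps do not increase the trace norm. -/
lemma traceNorm_map_le {T : Matrix ι ι ℂ →ₗ[ℂ] Matrix ι ι ℂ}
    (hpos : ∀ A : Matrix ι ι ℂ, A.PosSemidef → (T A).PosSemidef)
    (htr : ∀ A, (T A).trace = A.trace) {A : Matrix ι ι ℂ} (hA : A.IsHermitian) :
    traceNorm (T A) ≤ traceNorm A := by
  obtain ⟨P, N, hP, hN, rfl, h⟩ := exists_posSemidef_sub hA
  rw [map_sub, ← h, ← htr P, ← htr N]
  exact traceNorm_sub_le (hpos P hP) (hpos N hN)

/-- The trace distance is bounded from below by the bias of any projective measurement. -/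
lemma two_mul_re_trace_projection_le {P A : Matrix ι ι ℂ} (hP : P.IsHermitian) (hPP : P * P = P)
    (hA : A.IsHermitian) (htr : A.trace = 0) : 2 * (P * A).trace.re ≤ traceNorm A := by
  -- The reflection `2P - 1` is unitary, and its `-1` contributes nothing because `A` is traceless.
  have hW : (P + P - 1) ∈ unitaryGroup ι ℂ := by
    rw [mem_unitaryGroup_iff, star_eq_conjTranspose, conjTranspose_sub, conjTranspose_add, hP.eq,
      conjTranspose_one]
    simp only [Matrix.mul_sub, Matrix.sub_mul, Matrix.mul_add, Matrix.add_mul, hPP, Matrix.mul_one,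
      Matrix.one_mul]
    abel
  have := re_trace_unitary_mul_le hA hW
  rw [Matrix.sub_mul, Matrix.add_mul, Matrix.one_mul, trace_sub, trace_add, htr] at this
  simp only [sub_zero, Complex.add_re] at this
  linarith

/-- A supremum of continuous functions is lower semicontinuous: superlevel sets are unions of open
sets over all unitaries. This is all the integrals need. -/
lemma measurable_traceNorm {X : Type*} [TopologicalSpace X] [MeasurableSpace X]
    [OpensMeasurableSpace X] {f : X → Matrix ι ι ℂ} (hf : Continuous f)
    (hH : ∀ x, (f x).IsHermitian) : Measurable fun x => traceNorm (f x) := by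
  refine measurable_of_Ioi fun c => IsOpen.measurableSet ?_
  have : (fun x => traceNorm (f x)) ⁻¹' Set.Ioi c =
      ⋃ W : unitaryGroup ι ℂ, {x | c < ((W : Matrix ι ι ℂ) * f x).trace.re} := by
    ext x
    simp only [Set.mem_preimage, Set.mem_Ioi, Set.mem_iUnion, Set.mem_ofPred_eq]
    constructor
    · intro h
      obtain ⟨W, hW, h'⟩ := exists_unitary_re_trace_eq (hH x)
      exact ⟨⟨W, hW⟩, by rw [h']; exact h⟩
    · rintro ⟨W, h⟩
      exact h.trans_le (re_trace_unitary_mul_le (hH x) W.2)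
  rw [this]
  refine isOpen_iUnion fun W => isOpen_lt continuous_const ?_
  exact Complex.continuous_re.comp (continuous_const.matrix_mul hf).matrix_trace

end TraceNorm

/-! ### Typical sequences of independent samples, by Chebyshev's inequality. -/

section Typicality

variable {A : Type} [Fintype A] {J : Type} [Fintype J] [DecidableEq J]

/-- The Shannon entropy in bits of a weight function. -/
noncomputable def shannonEntropy (p : A → ℝ) : ℝ := -∑ a, p a * Real.logb 2 (p a)

/-- The variance of the surprisal `-log₂ p`. -/
noncomputable def varentropy (p : A → ℝ) : ℝ :=
  ∑ a, p a * (-Real.logb 2 (p a) - shannonEntropy p) ^ 2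

lemma sum_mul_surprisal_sub {p : A → ℝ} (hs : ∑ a, p a = 1) :
    ∑ a, p a * (-Real.logb 2 (p a) - shannonEntropy p) = 0 := by
  simp only [mul_sub, Finset.sum_sub_distrib, ← Finset.sum_mul, hs, mul_neg,
    Finset.sum_neg_distrib]
  simp [shannonEntropy]

/-- The second moment of a sum of independent centred functions. -/
lemma sum_prod_mul_sq_sum {p g : A → ℝ} (hs : ∑ a, p a = 1) (hg : ∑ a, p a * g a = 0) :
    ∑ f : J → A, (∏ j, p (f j)) * (∑ j, g (f j)) ^ 2 =
      Fintype.card J * ∑ a, p a * g a ^ 2 := by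
  classical
  -- The indicators put each term in product form over all positions, so that summing over `f`
  -- factors. Off-diagonal terms then vanish because `g` is centred.
  have h1 : ∀ f : J → A, (∏ j, p (f j)) * (∑ j, g (f j)) ^ 2 = ∑ j, ∑ k,
      ∏ i, p (f i) * (if i = j then g (f i) else 1) * (if i = k then g (f i) else 1) := by
    intro f
    rw [sq, Finset.sum_mul_sum, Finset.mul_sum]
    refine Finset.sum_congr rfl fun j _ => ?_
    rw [Finset.mul_sum]
    refine Finset.sum_congr rfl fun k _ => ?_
    rw [Finset.prod_mul_distrib, Finset.prod_mul_distrib]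
    simp [mul_assoc]
  have h2 : ∀ j k : J, ∑ f : J → A,
      ∏ i, p (f i) * (if i = j then g (f i) else 1) * (if i = k then g (f i) else 1) =
      if j = k then ∑ a, p a * g a ^ 2 else 0 := by
    intro j k
    rw [← Fintype.prod_sum
      (fun i a => p a * (if i = j then g a else 1) * (if i = k then g a else 1))]
    split_ifs with h
    · subst h
      rw [Finset.prod_eq_single j]
      · simp [sq, mul_assoc]
      · intro i _ hi
        simp [hi, hs]
      · simp
    · refine Finset.prod_eq_zero (Finset.mem_univ j) ?_
      simpa [h] using hg
  simp only [h1]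
  rw [Finset.sum_comm]
  simp only [Finset.sum_comm (s := (Finset.univ : Finset (J → A))), h2]
  simp

open Classical in
/-- Sequences whose probability is at least `2 ^ (-(N S + t))`. -/
noncomputable def typicalSet (J : Type) [Fintype J] [DecidableEq J] (p : A → ℝ) (t : ℝ) : Finset (J → A) :=
  Finset.univ.filter fun f =>
    (2 : ℝ) ^ (-(Fintype.card J * shannonEntropy p + t)) ≤ ∏ j, p (f j)

/-- The total mass is 1 and each member weighs at least the threshold. Only the size of the set
matters later, so no upper bound on individual weights is imposed. -/
lemma card_typicalSet_le {p : A → ℝ} (hp : ∀ a, 0 ≤ p a) (hs : ∑ a, p a = 1) (t : ℝ) :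
    ((typicalSet J p t).card : ℝ) ≤ (2 : ℝ) ^ (Fintype.card J * shannonEntropy p + t) := by
  classical
  have h1 : ∑ f : J → A, ∏ j, p (f j) = 1 := by
    rw [← Fintype.prod_sum (fun _ a => p a)]; simp [hs]
  have h2 : ((typicalSet J p t).card : ℝ) *
      (2 : ℝ) ^ (-(Fintype.card J * shannonEntropy p + t)) ≤ 1 := by
    rw [← h1, ← nsmul_eq_mul, ← Finset.sum_const]
    refine (Finset.sum_le_sum fun f hf => (Finset.mem_filter.mp hf).2).trans ?_
    exact Finset.sum_le_univ_sum_of_nonneg fun f => Finset.prod_nonneg fun j _ => hp _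
  rwa [Real.rpow_neg zero_le_two, ← div_eq_mul_inv, div_le_one (by positivity)] at h2

lemma le_sum_typicalSet {p : A → ℝ} (hp : ∀ a, 0 ≤ p a) (hs : ∑ a, p a = 1) {t : ℝ} (ht : 0 < t) :
    1 - Fintype.card J * varentropy p / t ^ 2 ≤ ∑ f ∈ typicalSet J p t, ∏ j, p (f j) := by
  classical
  set g : A → ℝ := fun a => -Real.logb 2 (p a) - shannonEntropy p with hg
  have h1 : ∑ f : J → A, ∏ j, p (f j) = 1 := by
    rw [← Fintype.prod_sum (fun _ a => p a)]; simp [hs]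
  have h2 := sum_prod_mul_sq_sum (J := J) hs (sum_mul_surprisal_sub hs)
  have hnn : ∀ f : J → A, 0 ≤ ∏ j, p (f j) := fun f => Finset.prod_nonneg fun j _ => hp _
  have h3 : ∑ f ∈ (typicalSet J p t)ᶜ, ∏ j, p (f j) ≤ Fintype.card J * varentropy p / t ^ 2 := by
    rw [varentropy, ← h2, Finset.sum_div]
    refine (Finset.sum_le_sum (g := fun f => (∏ j, p (f j)) * (∑ j, g (f j)) ^ 2 / t ^ 2)
      fun f hf => ?_).trans
      (Finset.sum_le_univ_sum_of_nonneg fun f => by have := hnn f; positivity)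
    rw [mul_div_assoc]
    -- Sequences of weight zero contribute nothing, and the logarithm of their product would not
    -- split.
    rcases (hnn f).eq_or_lt with h0 | h0
    · rw [← h0]; simp
    -- Outside the typical set the total surprisal exceeds its mean by more than `t`, so the
    -- Chebyshev factor is at least 1.
    refine le_mul_of_one_le_right h0.le ?_
    rw [one_le_div (by positivity)]
    refine pow_le_pow_left₀ ht.le ?_ 2
    have hf' : ∏ j, p (f j) < (2 : ℝ) ^ (-(Fintype.card J * shannonEntropy p + t)) := by
      simpa [typicalSet] using hf
    have h4 := (Real.logb_lt_iff_lt_rpow one_lt_two h0).mpr hf'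
    rw [Real.logb_prod _ _ fun j _ => (Finset.prod_ne_zero_iff.mp h0.ne') j (Finset.mem_univ j)]
      at h4
    simp only [hg, Finset.sum_sub_distrib, Finset.sum_neg_distrib, Finset.sum_const,
      Finset.card_univ, nsmul_eq_mul]
    linarith
  have h4 := Finset.sum_add_sum_compl (typicalSet J p t) fun f => ∏ j, p (f j)
  linarith

lemma mul_logb_sq_le {x : ℝ} (h0 : 0 ≤ x) (h1 : x ≤ 1) :
    x * Real.logb 2 x ^ 2 ≤ 4 / Real.log 2 ^ 2 := by
  rcases h0.eq_or_lt with rfl | h0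
  · rw [zero_mul]; positivity
  -- Applying `|y log y| < 1` at `y = √x` and squaring gives `x (log x)² ≤ 4`.
  have h2 := Real.abs_log_mul_self_lt (√x) (Real.sqrt_pos.mpr h0) (Real.sqrt_le_one.mpr h1)
  have h3 : (Real.log (√x) * √x) ^ 2 ≤ 1 := by
    rw [← sq_abs]; exact pow_le_one₀ (abs_nonneg _) h2.le
  rw [mul_pow, Real.sq_sqrt h0.le, Real.log_sqrt h0.le] at h3
  rw [Real.logb, div_pow, ← mul_div_assoc]
  gcongr
  nlinarith

/-- The varentropy is bounded in terms of the size of the support. -/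
lemma varentropy_le {p : A → ℝ} (hp : ∀ a, 0 ≤ p a) (hs : ∑ a, p a = 1) {K : ℕ}
    (hK : Fintype.card {a // p a ≠ 0} ≤ K) : varentropy p ≤ K * (4 / Real.log 2 ^ 2) := by
  classical
  have hp1 : ∀ a, p a ≤ 1 := fun a => by
    rw [← hs]; exact Finset.single_le_sum (fun a _ => hp a) (Finset.mem_univ a)
  have h1 : varentropy p ≤ ∑ a, p a * Real.logb 2 (p a) ^ 2 := by
    -- The variance is at most the second moment, to which only the support contributes, by a
    -- bounded amount per point.
    have h : varentropy p = ∑ a, p a * Real.logb 2 (p a) ^ 2 - shannonEntropy p ^ 2 := by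
      have e : ∀ a, p a * (-Real.logb 2 (p a) - shannonEntropy p) ^ 2 =
          p a * Real.logb 2 (p a) ^ 2 + 2 * shannonEntropy p * (p a * Real.logb 2 (p a)) +
            p a * shannonEntropy p ^ 2 := fun a => by ring
      have e2 : ∑ a, p a * Real.logb 2 (p a) = -shannonEntropy p := by simp [shannonEntropy]
      simp only [varentropy, e, Finset.sum_add_distrib, ← Finset.mul_sum, ← Finset.sum_mul, hs, e2]
      ring
    rw [h]; nlinarith [sq_nonneg (shannonEntropy p)]
  refine h1.trans ?_
  have h2 : ∑ a, p a * Real.logb 2 (p a) ^ 2 =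
      ∑ a ∈ Finset.univ.filter fun a => p a ≠ 0, p a * Real.logb 2 (p a) ^ 2 := by
    symm
    refine Finset.sum_filter_of_ne fun a _ h h0 => h (by simp [h0])
  rw [h2]
  refine (Finset.sum_le_card_nsmul _ _ _ fun a _ => mul_logb_sq_le (hp a) (hp1 a)).trans ?_
  rw [nsmul_eq_mul, ← Fintype.card_subtype]
  have : (0 : ℝ) ≤ 4 / Real.log 2 ^ 2 := by positivity
  gcongr

end Typicality

/-! ### First moments of unitary and state 1-designs. -/

section Designs

variable {ι : Type} [Fintype ι] [DecidableEq ι]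

instance : SecondCountableTopology (Matrix.unitaryGroup ι ℂ) :=
  haveI : SecondCountableTopology (Matrix ι ι ℂ) :=
    inferInstanceAs (SecondCountableTopology (ι → ι → ℂ))
  (Topology.IsInducing.subtypeVal
    (Y := Matrix ι ι ℂ) (t := {U | U ∈ Matrix.unitaryGroup ι ℂ})).secondCountableTopology

instance : IsProbabilityMeasure (haarUnitary ι) :=
  ⟨Measure.haarMeasure_self (G := Matrix.unitaryGroup ι ℂ) (K₀ := ⊤)⟩

instance : (haarUnitary ι).IsMulLeftInvariant :=
  inferInstanceAs (Measure.haarMeasure _).IsMulLeftInvariant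

lemma Continuous.integrable_of_compactSpace {X E : Type*} [TopologicalSpace X] [CompactSpace X]
    [MeasurableSpace X] [OpensMeasurableSpace X] [NormedAddCommGroup E]
    [SecondCountableTopology E] {μ : Measure X} [IsFiniteMeasure μ] {f : X → E}
    (hf : Continuous f) : Integrable f μ := by
  borelize E
  obtain ⟨C, hC⟩ := isCompact_univ.exists_bound_of_continuousOn hf.continuousOn
  exact Integrable.of_bound hf.aestronglyMeasurable C (ae_of_all _ fun x => hC x (Set.mem_univ x))

lemma continuous_unitary_entry (i j : ι) :
    Continuous fun U : Matrix.unitaryGroup ι ℂ => (U : Matrix ι ι ℂ) i j :=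
  continuous_subtype_val.matrix_elem i j

lemma continuous_entry_mul_star (i j k l : ι) :
    Continuous fun U : Matrix.unitaryGroup ι ℂ =>
      (U : Matrix ι ι ℂ) i k * star ((U : Matrix ι ι ℂ) j l) :=
  (continuous_unitary_entry i k).mul (continuous_unitary_entry j l).star

/-- The Haar average of `U i k * conj (U j l)`. -/
lemma integral_haarUnitary_entry (i j k l : ι) :
    ∫ U, (U : Matrix ι ι ℂ) i k * star ((U : Matrix ι ι ℂ) j l) ∂(haarUnitary ι) =
      if i = j ∧ k = l then (Fintype.card ι : ℂ)⁻¹ else 0 := by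
  have hinv : ∀ (V : Matrix.unitaryGroup ι ℂ) (a b : ι),
      ∫ U, ((V : Matrix ι ι ℂ) * (U : Matrix ι ι ℂ)) a k *
        star (((V : Matrix ι ι ℂ) * (U : Matrix ι ι ℂ)) b l) ∂(haarUnitary ι) =
      ∫ U, (U : Matrix ι ι ℂ) a k * star ((U : Matrix ι ι ℂ) b l) ∂(haarUnitary ι) := fun V a b =>
    integral_mul_left_eq_self
      (fun U : Matrix.unitaryGroup ι ℂ => (U : Matrix ι ι ℂ) a k * star ((U : Matrix ι ι ℂ) b l)) V
  have hdiag : ∀ a b : ι,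
      ∫ U, (U : Matrix ι ι ℂ) a k * star ((U : Matrix ι ι ℂ) a l) ∂(haarUnitary ι) =
      ∫ U, (U : Matrix ι ι ℂ) b k * star ((U : Matrix ι ι ℂ) b l) ∂(haarUnitary ι) := by
    intro a b
    -- Invariance under row swaps makes the diagonal averages independent of the row; column
    -- orthonormality then fixes their sum.
    let V : Matrix ι ι ℂ := (Equiv.swap a b).toPEquiv.toMatrix
    have hV : V ∈ Matrix.unitaryGroup ι ℂ := by
      rw [mem_unitaryGroup_iff]
      ext x y
      simp only [V, star_eq_conjTranspose, PEquiv.toMatrix_toPEquiv_mul, submatrix_apply,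
        conjTranspose_apply, PEquiv.toMatrix_apply, one_apply]
      by_cases h : x = y <;> simp [h, eq_comm]
    have := hinv ⟨V, hV⟩ b b
    simpa [V, PEquiv.toMatrix_toPEquiv_mul] using this
  by_cases hij : i = j
  · subst hij
    have hsum : ∑ a, ∫ U, (U : Matrix ι ι ℂ) a k * star ((U : Matrix ι ι ℂ) a l) ∂(haarUnitary ι) =
        if k = l then 1 else 0 := by
      rw [← integral_finsetSum _ fun a _ =>
        (continuous_entry_mul_star a a k l).integrable_of_compactSpace]
      have : ∀ U : Matrix.unitaryGroup ι ℂ,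
          ∑ a, (U : Matrix ι ι ℂ) a k * star ((U : Matrix ι ι ℂ) a l) = if k = l then 1 else 0 := by
        intro U
        have h := congrFun (congrFun (mem_unitaryGroup_iff'.mp U.2) l) k
        rw [star_eq_conjTranspose, mul_apply, one_apply] at h
        simp only [conjTranspose_apply, eq_comm (a := l)] at h
        rw [← h]
        exact Finset.sum_congr rfl fun a _ => mul_comm _ _
      simp only [this, integral_const, probReal_univ, one_smul]
    rw [Finset.sum_congr rfl fun a _ => hdiag a i] at hsum
    have hd : (Fintype.card ι : ℂ) ≠ 0 := by
      have : Nonempty ι := ⟨i⟩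
      exact_mod_cast Fintype.card_ne_zero
    rw [Finset.sum_const, Finset.card_univ, nsmul_eq_mul] at hsum
    rw [eq_comm, ← mul_right_inj' hd, hsum]
    split_ifs with h1 h2 h2
    · exact mul_inv_cancel₀ hd
    · exact absurd h1.2 h2
    · exact absurd ⟨rfl, h2⟩ h1
    · simp
  · rw [if_neg fun h => hij h.1]
    -- Flipping the sign of row `i` negates the integrand when `i ≠ j`, so its average is 0.
    let V : Matrix ι ι ℂ := diagonal fun x => if x = i then -1 else 1
    have hV : V ∈ Matrix.unitaryGroup ι ℂ := by
      rw [mem_unitaryGroup_iff, star_eq_conjTranspose, diagonal_conjTranspose,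
        diagonal_mul_diagonal, ← diagonal_one]
      congr 1
      ext x
      simp only [Pi.star_apply]
      split_ifs <;> simp
    have := hinv ⟨V, hV⟩ i j
    simp only [V, diagonal_mul, if_true, if_neg (Ne.symm hij), neg_mul, one_mul,
      integral_neg] at this
    exact self_eq_neg.mp this.symm

lemma IsUnitaryDesign.integral_entry {μ : Measure (Matrix.unitaryGroup ι ℂ)}
    (hμ : IsUnitaryDesign 1 μ) (i j k l : ι) :
    ∫ U, (U : Matrix ι ι ℂ) i k * star ((U : Matrix ι ι ℂ) j l) ∂μ =
      if i = j ∧ k = l then (Fintype.card ι : ℂ)⁻¹ else 0 := by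
  have h := hμ.integral_eq (MvPolynomial.X (Sum.inl (i, k)) * MvPolynomial.X (Sum.inr (j, l))) <| by
    have h1 := (MvPolynomial.isWeightedHomogeneous_X ℂ
      (Sum.elim (fun _ : ι × ι => ((1, 0) : ℕ × ℕ)) (fun _ : ι × ι => ((0, 1) : ℕ × ℕ)))
      (Sum.inl (i, k))).mul (MvPolynomial.isWeightedHomogeneous_X ℂ _ (Sum.inr (j, l)))
    exact h1
  simp only [evalUnitary, map_mul, MvPolynomial.eval_X, Sum.elim_inl, Sum.elim_inr] at h
  rw [h, integral_haarUnitary_entry]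

lemma LinearMap.eq_sum_matrix_single (ℓ : Matrix ι ι ℂ →ₗ[ℂ] ℂ) (X : Matrix ι ι ℂ) :
    ℓ X = ∑ i, ∑ j, X i j * ℓ (Matrix.single i j 1) := by
  conv_lhs => rw [matrix_eq_sum_single X]
  simp only [map_sum]
  refine Finset.sum_congr rfl fun i _ => Finset.sum_congr rfl fun j _ => ?_
  rw [← smul_eq_mul, ← map_smul, smul_single, smul_eq_mul, mul_one]

lemma continuous_unitaryConj_apply (X : Matrix ι ι ℂ) :
    Continuous fun U : Matrix.unitaryGroup ι ℂ => unitaryConj U X :=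
  (continuous_subtype_val.matrix_mul continuous_const).matrix_mul
    continuous_subtype_val.matrix_conjTranspose

/-- Averaging over a unitary `1`-design is the completely depolarizing channel. -/
lemma IsUnitaryDesign.integral_linear {μ : Measure (Matrix.unitaryGroup ι ℂ)}
    (hμ : IsUnitaryDesign 1 μ) (ℓ : Matrix ι ι ℂ →ₗ[ℂ] ℂ) (X : Matrix ι ι ℂ) :
    ∫ U, ℓ (unitaryConj U X) ∂μ = X.trace / Fintype.card ι * ℓ 1 := by
  have := hμ.isProbabilityMeasure
  have hE : ∀ i j : ι, ∫ U, unitaryConj U X i j ∂μ =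
      if i = j then X.trace / Fintype.card ι else 0 := by
    intro i j
    have : ∀ U : Matrix.unitaryGroup ι ℂ, unitaryConj U X i j = ∑ k, ∑ l,
        ((U : Matrix ι ι ℂ) i k * star ((U : Matrix ι ι ℂ) j l)) * X k l := by
      intro U
      simp only [unitaryConj, LinearMap.coe_mk, AddHom.coe_mk, mul_apply, conjTranspose_apply,
        Finset.sum_mul]
      rw [Finset.sum_comm]
      exact Finset.sum_congr rfl fun k _ => Finset.sum_congr rfl fun l _ => by ring
    have hI : ∀ k l : ι, Integrable (fun U : Matrix.unitaryGroup ι ℂ =>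
        ((U : Matrix ι ι ℂ) i k * star ((U : Matrix ι ι ℂ) j l)) * X k l) μ := fun k l =>
      ((continuous_entry_mul_star i j k l).integrable_of_compactSpace).mul_const _
    have h2 : ∀ k, ∫ U : Matrix.unitaryGroup ι ℂ, ∑ l,
        ((U : Matrix ι ι ℂ) i k * star ((U : Matrix ι ι ℂ) j l)) * X k l ∂μ =
        if i = j then (Fintype.card ι : ℂ)⁻¹ * X k k else 0 := by
      intro k
      rw [integral_finsetSum _ fun l _ => hI k l]
      simp only [integral_mul_const, hμ.integral_entry, ite_mul, zero_mul]
      by_cases h : i = j <;> simp [h]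
    rw [integral_congr_ae (ae_of_all _ this),
      integral_finsetSum _ fun k _ => integrable_finsetSum _ fun l _ => hI k l]
    simp only [h2]
    split_ifs
    · rw [← Finset.mul_sum, div_eq_inv_mul]; rfl
    · simp
  have hint : ∀ i j : ι, Integrable (fun U : Matrix.unitaryGroup ι ℂ =>
      unitaryConj U X i j * ℓ (Matrix.single i j 1)) μ := fun i j =>
    (((continuous_unitaryConj_apply X).matrix_elem i j).integrable_of_compactSpace).mul_const _
  simp only [ℓ.eq_sum_matrix_single (unitaryConj _ X)]
  rw [integral_finsetSum _ fun i _ => integrable_finsetSum _ fun j _ => hint i j]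
  simp only [integral_finsetSum _ fun j _ => hint _ j, integral_mul_const, hE]
  rw [ℓ.eq_sum_matrix_single 1]
  simp only [one_apply, ite_mul, one_mul, zero_mul, Finset.sum_ite_eq, Finset.mem_univ, if_true,
    Finset.mul_sum]

omit [Fintype ι] [DecidableEq ι] in
lemma continuous_pureState : Continuous (pureState : EuclideanSpace ℂ ι → Matrix ι ι ℂ) :=
  continuous_matrix fun i j =>
    (EuclideanSpace.proj i : EuclideanSpace ℂ ι →L[ℂ] ℂ).continuous.mul
      (EuclideanSpace.proj j : EuclideanSpace ℂ ι →L[ℂ] ℂ).continuous.star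

omit [Fintype ι] [DecidableEq ι] in
lemma pureState_eq_vecMulVec (ψ : EuclideanSpace ℂ ι) :
    pureState ψ = vecMulVec ψ (star (ψ : ι → ℂ)) := rfl

omit [DecidableEq ι] in
lemma posSemidef_pureState (ψ : EuclideanSpace ℂ ι) : (pureState ψ).PosSemidef :=
  posSemidef_vecMulVec_self_star _

omit [DecidableEq ι] in
lemma trace_pureState (ψ : EuclideanSpace ℂ ι) : (pureState ψ).trace = ((‖ψ‖ ^ 2 : ℝ) : ℂ) := by
  simp only [trace, diag, pureState, of_apply, EuclideanSpace.norm_sq_eq, Complex.ofReal_sum]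
  exact Finset.sum_congr rfl fun i _ => by
    rw [Complex.star_def, Complex.mul_conj, Complex.normSq_eq_norm_sq]

lemma pureState_toEuclideanLin (U : Matrix.unitaryGroup ι ℂ) (ψ : EuclideanSpace ℂ ι) :
    pureState (toEuclideanLin (U : Matrix ι ι ℂ) ψ) = unitaryConj U (pureState ψ) := by
  change _ = (U : Matrix ι ι ℂ) * pureState ψ * (U : Matrix ι ι ℂ)ᴴ
  rw [pureState_eq_vecMulVec, pureState_eq_vecMulVec, mul_vecMulVec, vecMulVec_mul,
    ← star_mulVec]
  rfl

lemma continuous_toEuclideanLin_apply (ψ : EuclideanSpace ℂ ι) :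
    Continuous fun U : Matrix.unitaryGroup ι ℂ => toEuclideanLin (U : Matrix ι ι ℂ) ψ :=
  (PiLp.continuous_toLp 2 _).comp (continuous_subtype_val.matrix_mulVec continuous_const)

lemma IsStateDesign.isProbabilityMeasure {t : ℕ} {ν : Measure (EuclideanSpace ℂ ι)}
    (hν : IsStateDesign t ν) : IsProbabilityMeasure ν := by
  obtain ⟨φ₀, μ, -, hμ, rfl⟩ := hν
  have := hμ.isProbabilityMeasure
  exact Measure.isProbabilityMeasure_map (continuous_toEuclideanLin_apply φ₀).aemeasurable

lemma IsStateDesign.ae_norm_eq_one {t : ℕ} {ν : Measure (EuclideanSpace ℂ ι)}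
    (hν : IsStateDesign t ν) : ∀ᵐ ψ ∂ν, ‖ψ‖ = 1 := by
  obtain ⟨φ₀, μ, h0, hμ, rfl⟩ := hν
  rw [ae_map_iff (continuous_toEuclideanLin_apply φ₀).aemeasurable
    (isClosed_eq continuous_norm continuous_const).measurableSet]
  refine ae_of_all _ fun U => ?_
  have h := trace_pureState (toEuclideanLin (U : Matrix ι ι ℂ) φ₀)
  rw [pureState_toEuclideanLin] at h
  change ((U : Matrix ι ι ℂ) * pureState φ₀ * (U : Matrix ι ι ℂ)ᴴ).trace = _ at h
  rw [trace_mul_comm, ← Matrix.mul_assoc,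
    show (U : Matrix ι ι ℂ)ᴴ * (U : Matrix ι ι ℂ) = 1 from Unitary.coe_star_mul_self U,
    Matrix.one_mul, trace_pureState, h0] at h
  have h2 : (1 : ℝ) ^ 2 = ‖toEuclideanLin (U : Matrix ι ι ℂ) φ₀‖ ^ 2 := by exact_mod_cast h
  nlinarith [norm_nonneg (toEuclideanLin (U : Matrix ι ι ℂ) φ₀)]

/-- The average of a state `1`-design is the maximally mixed state. -/
lemma IsStateDesign.integral_linear {ν : Measure (EuclideanSpace ℂ ι)}
    (hν : IsStateDesign 1 ν) (ℓ : Matrix ι ι ℂ →ₗ[ℂ] ℂ) :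
    ∫ ψ, ℓ (pureState ψ) ∂ν = ℓ 1 / Fintype.card ι := by
  obtain ⟨φ₀, μ, h0, hμ, rfl⟩ := hν
  have hc : Continuous fun ψ : EuclideanSpace ℂ ι => ℓ (pureState ψ) := by
    simp only [ℓ.eq_sum_matrix_single (pureState _)]
    exact continuous_finsetSum _ fun i _ => continuous_finsetSum _ fun j _ =>
      (continuous_pureState.matrix_elem i j).mul continuous_const
  rw [integral_map (continuous_toEuclideanLin_apply φ₀).aemeasurable hc.aestronglyMeasurable]
  simp only [pureState_toEuclideanLin]
  rw [hμ.integral_linear, trace_pureState, h0]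
  simp [div_eq_inv_mul]

end Designs

/-! ### Expansion of the circuit into Kraus paths and their average weights. -/

section KrausPaths

variable {ι : Type} [Fintype ι] [DecidableEq ι] {A : Type} [Fintype A]

/-- `Φ = ∑ a, K a · (K a)†`, where the Kraus operator `K a` has weight `p a`. -/
structure IsKrausForm (Φ : Matrix ι ι ℂ →ₗ[ℂ] Matrix ι ι ℂ) (K : A → Matrix ι ι ℂ)
    (p : A → ℝ) : Prop where
  apply : ∀ X, Φ X = ∑ a, K a * X * (K a)ᴴ
  trace : ∀ a, (K a * (K a)ᴴ).trace = Fintype.card ι * p a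

/-- The product of the unitary layers and of a choice of a Kraus operator after each layer. -/
def krausPath (K : A → Matrix ι ι ℂ) :
    (D : ℕ) → (Fin D → A) → (Fin D → Matrix.unitaryGroup ι ℂ) → Matrix ι ι ℂ
  | 0, _, _ => 1
  | D + 1, α, U => K (α (Fin.last D)) * (U (Fin.last D) : Matrix ι ι ℂ) *
      krausPath K D (fun k => α k.castSucc) (fun k => U k.castSucc)

variable {Φ : Matrix ι ι ℂ →ₗ[ℂ] Matrix ι ι ℂ} {K : A → Matrix ι ι ℂ} {p : A → ℝ}

lemma noisyCircuit_eq_sum (h : IsKrausForm Φ K p) (D : ℕ)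
    (U : Fin D → Matrix.unitaryGroup ι ℂ) (X : Matrix ι ι ℂ) :
    noisyCircuit Φ D U X = ∑ α : Fin D → A, krausPath K D α U * X * (krausPath K D α U)ᴴ := by
  induction D with
  | zero => simp [noisyCircuit, krausPath]
  | succ D ih =>
    change Φ (unitaryConj (U (Fin.last D)) (noisyCircuit Φ D (fun k => U k.castSucc) X)) = _
    rw [ih, h.apply, ← (Fin.snocEquiv fun _ : Fin (D + 1) => A).sum_comp, Fintype.sum_prod_type]
    refine Finset.sum_congr rfl fun a _ => ?_
    rw [map_sum, Matrix.mul_sum, Matrix.sum_mul]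
    refine Finset.sum_congr rfl fun α _ => ?_
    simp [krausPath, unitaryConj, Fin.snocEquiv, conjTranspose_mul, Matrix.mul_assoc]

lemma trace_noisyCircuit (h : ∀ X, (Φ X).trace = X.trace) (D : ℕ)
    (U : Fin D → Matrix.unitaryGroup ι ℂ) (X : Matrix ι ι ℂ) :
    (noisyCircuit Φ D U X).trace = X.trace := by
  induction D with
  | zero => rfl
  | succ D ih =>
    change (Φ (unitaryConj (U (Fin.last D)) (noisyCircuit Φ D (fun k => U k.castSucc) X))).trace = _
    rw [h, ← ih fun k => U k.castSucc]
    change (_ * _ * _ : Matrix ι ι ℂ).trace = _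
    rw [trace_mul_comm, ← Matrix.mul_assoc,
      show (U (Fin.last D) : Matrix ι ι ℂ)ᴴ * (U (Fin.last D) : Matrix ι ι ℂ) = 1 from
        Unitary.coe_star_mul_self _, Matrix.one_mul]

lemma noisyCircuit_one (h : IsUnital Φ) (D : ℕ) (U : Fin D → Matrix.unitaryGroup ι ℂ) :
    noisyCircuit Φ D U 1 = 1 := by
  induction D with
  | zero => rfl
  | succ D ih =>
    change Φ (unitaryConj (U (Fin.last D)) (noisyCircuit Φ D (fun k => U k.castSucc) 1)) = _
    rw [ih]
    change Φ (_ * _ * _) = _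
    rw [Matrix.mul_one, show (U (Fin.last D) : Matrix ι ι ℂ) * (U (Fin.last D) : Matrix ι ι ℂ)ᴴ = 1
      from Unitary.coe_mul_star_self _]
    exact h

omit [Fintype A] in
lemma continuous_krausPath (K : A → Matrix ι ι ℂ) (D : ℕ) (α : Fin D → A) :
    Continuous (krausPath K D α) := by
  induction D with
  | zero => exact continuous_const
  | succ D ih =>
    exact (continuous_const.matrix_mul
      (continuous_subtype_val.comp (continuous_apply (Fin.last D)))).matrix_mul
      ((ih _).comp (continuous_pi fun k => continuous_apply k.castSucc))

lemma posSemidef_noisyCircuit (h : IsKrausForm Φ K p) (D : ℕ)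
    (U : Fin D → Matrix.unitaryGroup ι ℂ) {X : Matrix ι ι ℂ} (hX : X.PosSemidef) :
    (noisyCircuit Φ D U X).PosSemidef := by
  rw [noisyCircuit_eq_sum h]
  exact posSemidef_sum _ fun α _ => hX.mul_mul_conjTranspose_same _

lemma continuous_noisyCircuit (h : IsKrausForm Φ K p) (D : ℕ) {X : Type*} [TopologicalSpace X]
    {u : X → Fin D → Matrix.unitaryGroup ι ℂ} {x : X → Matrix ι ι ℂ} (hu : Continuous u)
    (hx : Continuous x) : Continuous fun ω => noisyCircuit Φ D (u ω) (x ω) := by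
  simp only [noisyCircuit_eq_sum h]
  exact continuous_finsetSum _ fun α _ =>
    ((((continuous_krausPath K D α).comp hu).matrix_mul hx).matrix_mul
      ((continuous_krausPath K D α).comp hu).matrix_conjTranspose)

/-- The average weight of a path through layers drawn from `1`-designs. -/
lemma integral_trace_krausPath (h : IsKrausForm Φ K p) (hd : (Fintype.card ι : ℂ) ≠ 0) (D : ℕ)
    (μ : Fin D → Measure (Matrix.unitaryGroup ι ℂ)) (hμ : ∀ k, IsUnitaryDesign 1 (μ k))
    (α : Fin D → A) (X : Matrix ι ι ℂ) :
    ∫ U, (krausPath K D α U * X * (krausPath K D α U)ᴴ).trace ∂(Measure.pi μ) =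
      (∏ k, p (α k) : ℝ) * X.trace := by
  have := fun k => (hμ k).isProbabilityMeasure
  induction D with
  | zero => simp [krausPath]
  | succ D ih =>
    set f : (Fin (D + 1) → Matrix.unitaryGroup ι ℂ) → ℂ := fun U =>
      (krausPath K (D + 1) α U * X * (krausPath K (D + 1) α U)ᴴ).trace with hf
    have hfc : Continuous f :=
      (((continuous_krausPath K _ α).matrix_mul continuous_const).matrix_mul
        (continuous_krausPath K _ α).matrix_conjTranspose).matrix_trace
    have hmp := measurePreserving_piFinSuccAbove μ (Fin.last D)
    change ∫ U, f U ∂(Measure.pi μ) = _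
    -- The last layer is integrated innermost: its twirl leaves the trace of the shorter path,
    -- divided by `d`, times `tr (K a (K a)†) = d * p a`. The remaining layers are the induction
    -- hypothesis.
    rw [← (hmp.symm _).integral_comp (MeasurableEquiv.measurableEmbedding _) f,
      integral_prod_symm (fun z => f ((MeasurableEquiv.piFinSuccAbove
        (fun _ : Fin (D + 1) => Matrix.unitaryGroup ι ℂ) (Fin.last D)).symm z))
        ((hmp.symm _).integrable_comp_of_integrable hfc.integrable_of_compactSpace)]
    have hstep : ∀ U' : Fin D → Matrix.unitaryGroup ι ℂ,
        ∫ u, f ((MeasurableEquiv.piFinSuccAbove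
          (fun _ : Fin (D + 1) => Matrix.unitaryGroup ι ℂ) (Fin.last D)).symm (u, U'))
          ∂(μ (Fin.last D)) =
        p (α (Fin.last D)) * (krausPath K D (fun k => α k.castSucc) U' * X *
          (krausPath K D (fun k => α k.castSucc) U')ᴴ).trace := by
      intro U'
      let ℓ : Matrix ι ι ℂ →ₗ[ℂ] ℂ :=
        { toFun := fun Y => (K (α (Fin.last D)) * Y * (K (α (Fin.last D)))ᴴ).trace
          map_add' := fun Y Z => by simp [Matrix.mul_add, Matrix.add_mul]
          map_smul' := fun c Y => by simp }
      have hℓ := (hμ (Fin.last D)).integral_linear ℓ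
        (krausPath K D (fun k => α k.castSucc) U' * X *
          (krausPath K D (fun k => α k.castSucc) U')ᴴ)
      have h1 : ℓ 1 = Fintype.card ι * p (α (Fin.last D)) := by
        change (_ * 1 * _ : Matrix ι ι ℂ).trace = _
        rw [Matrix.mul_one, h.trace]
      rw [h1] at hℓ
      have h2 : ∀ u : Matrix.unitaryGroup ι ℂ, f ((MeasurableEquiv.piFinSuccAbove
          (fun _ : Fin (D + 1) => Matrix.unitaryGroup ι ℂ) (Fin.last D)).symm (u, U')) =
          ℓ (unitaryConj u (krausPath K D (fun k => α k.castSucc) U' * X *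
            (krausPath K D (fun k => α k.castSucc) U')ᴴ)) := by
        intro u
        simp only [hf, krausPath, ℓ, unitaryConj, LinearMap.coe_mk, AddHom.coe_mk]
        simp [MeasurableEquiv.piFinSuccAbove, Fin.insertNthEquiv, conjTranspose_mul,
          Matrix.mul_assoc]
      simp only [h2]
      rw [hℓ]
      field_simp
    simp only [hstep, integral_const_mul]
    have ih' := ih (fun k => μ k.castSucc) (fun k => hμ _) (fun k => α k.castSucc)
      fun k => this _
    simp only [Fin.succAbove_last]
    rw [ih', Fin.prod_univ_castSucc]
    push_cast
    ring

omit [Fintype A] in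
/-- A projection onto the span of finitely many vectors. -/
lemma exists_projection_of_finset {B : Type} (G : Finset B) (v : B → ι → ℂ) :
    ∃ P : Matrix ι ι ℂ, P.IsHermitian ∧ P * P = P ∧ (∀ b ∈ G, P *ᵥ v b = v b) ∧
      P.trace.re ≤ G.card := by
  classical
  induction G using Finset.induction_on with
  | empty => exact ⟨0, isHermitian_zero, by simp, by simp, by simp⟩
  | insert b G hb ih =>
    obtain ⟨P, hP, hPP, hPv, hPt⟩ := ih
    -- A Gram–Schmidt step: `w` is the component of the new vector orthogonal to the range of `P`.
    -- If it is nonzero, the rank-one projection onto it is added, which raises the trace by 1.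
    set w : ι → ℂ := v b - P *ᵥ v b with hw
    have hPw : P *ᵥ w = 0 := by simp [hw, mulVec_sub, mulVec_mulVec, hPP]
    have hwP : star w ᵥ* P = 0 := by
      have := congrArg star hPw
      rwa [star_mulVec, hP.eq, star_zero] at this
    by_cases hw0 : w = 0
    · refine ⟨P, hP, hPP, ?_, ?_⟩
      · intro c hc
        rcases Finset.mem_insert.mp hc with rfl | hc
        · exact (sub_eq_zero.mp hw0).symm
        · exact hPv c hc
      · rw [Finset.card_insert_of_notMem hb]; push_cast; linarith
    · set s : ℂ := star w ⬝ᵥ w with hs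
      have hs0 : s ≠ 0 := by rwa [hs, Ne, dotProduct_star_self_eq_zero]
      have hsr : star s = s := (star_dotProduct w w).symm
      have hQ : (vecMulVec w (star w))ᴴ = vecMulVec w (star w) := by
        rw [conjTranspose_vecMulVec, star_star]
      have hwv : star w ⬝ᵥ v b = s := by
        have : star w ⬝ᵥ (P *ᵥ v b) = 0 := by rw [dotProduct_mulVec, hwP, zero_dotProduct]
        rw [hs]; conv_rhs => rw [hw, dotProduct_sub]
        rw [← hw, this, sub_zero]
      refine ⟨P + s⁻¹ • vecMulVec w (star w), ?_, ?_, ?_, ?_⟩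
      · rw [IsHermitian, conjTranspose_add, conjTranspose_smul, hP.eq, hQ, star_inv₀, hsr]
      · rw [Matrix.add_mul, Matrix.mul_add, Matrix.mul_add, hPP, Matrix.mul_smul, Matrix.smul_mul,
          Matrix.smul_mul, Matrix.mul_smul, mul_vecMulVec, hPw, vecMulVec_mul, hwP,
          vecMulVec_mul_vecMulVec, ← hs]
        simp [hs0]
      · intro c hc
        rw [add_mulVec, smul_mulVec, vecMulVec_mulVec]
        rcases Finset.mem_insert.mp hc with rfl | hc
        · rw [hwv]
          simp [hs0, hw]
        · have : star w ⬝ᵥ v c = 0 := by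
            rw [← hPv c hc, dotProduct_mulVec, hwP, zero_dotProduct]
          rw [this, hPv c hc]
          simp
      · rw [trace_add, trace_smul, trace_vecMulVec, dotProduct_comm, ← hs, smul_eq_mul,
          inv_mul_cancel₀ hs0, Finset.card_insert_of_notMem hb]
        push_cast
        simp only [Complex.add_re, Complex.one_re]
        linarith

end KrausPaths

/-! ### Lower bound on the average contraction from a set of Kraus paths. -/

section AverageContraction

variable {ι : Type} [Fintype ι] [DecidableEq ι] {A : Type} [Fintype A]
  {Φ : Matrix ι ι ℂ →ₗ[ℂ] Matrix ι ι ℂ} {K : A → Matrix ι ι ℂ} {p : A → ℝ}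

lemma contractionRatio_nonneg (T : Matrix ι ι ℂ →ₗ[ℂ] Matrix ι ι ℂ) (ψ φ : EuclideanSpace ℂ ι) :
    0 ≤ contractionRatio T ψ φ :=
  div_nonneg (traceNorm_nonneg _) (traceNorm_nonneg _)

lemma contractionRatio_le_one {T : Matrix ι ι ℂ →ₗ[ℂ] Matrix ι ι ℂ}
    (hpos : ∀ X : Matrix ι ι ℂ, X.PosSemidef → (T X).PosSemidef)
    (htr : ∀ X, (T X).trace = X.trace) (ψ φ : EuclideanSpace ℂ ι) :
    contractionRatio T ψ φ ≤ 1 := by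
  refine div_le_one_of_le₀ ?_ (traceNorm_nonneg _)
  rw [← map_sub]
  exact traceNorm_map_le hpos htr ((posSemidef_pureState ψ).1.sub (posSemidef_pureState φ).1)

/-- The numerator is at least twice the bias of the measurement `P`, and the denominator is at most
2. Replacing the ratio by this bias leaves an expression linear in each of the two input states,
which a 1-design can average. -/
lemma le_contractionRatio {T : Matrix ι ι ℂ →ₗ[ℂ] Matrix ι ι ℂ}
    (hpos : ∀ X : Matrix ι ι ℂ, X.PosSemidef → (T X).PosSemidef)
    (htr : ∀ X, (T X).trace = X.trace) {ψ φ : EuclideanSpace ℂ ι} (hψ : ‖ψ‖ = 1) (hφ : ‖φ‖ = 1)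
    {P : Matrix ι ι ℂ} (hP : P.IsHermitian) (hPP : P * P = P) :
    (P * T (pureState ψ)).trace.re - (P * T (pureState φ)).trace.re ≤
      contractionRatio T ψ φ := by
  have hψs := posSemidef_pureState ψ
  have hφs := posSemidef_pureState φ
  have h1 : 2 * (P * (T (pureState ψ) - T (pureState φ))).trace.re ≤
      traceNorm (T (pureState ψ) - T (pureState φ)) := by
    refine two_mul_re_trace_projection_le hP hPP ((hpos _ hψs).1.sub (hpos _ hφs).1) ?_
    rw [trace_sub, htr, htr, trace_pureState, trace_pureState, hψ, hφ, sub_self]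
  rw [Matrix.mul_sub, trace_sub, Complex.sub_re] at h1
  have h2 : traceNorm (pureState ψ - pureState φ) ≤ 2 := by
    refine (traceNorm_sub_le hψs hφs).trans ?_
    rw [trace_pureState, trace_pureState, hψ, hφ]
    norm_num
  have h3 : traceNorm (T (pureState ψ) - T (pureState φ)) ≤
      traceNorm (pureState ψ - pureState φ) := by
    rw [← map_sub]
    exact traceNorm_map_le hpos htr (hψs.1.sub hφs.1)
  have h4 := traceNorm_nonneg (T (pureState ψ) - T (pureState φ))
  unfold contractionRatio
  -- For coinciding inputs the ratio is 0, but contractivity makes the numerator vanish as well, so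
  -- the bias is at most 0.
  rcases (traceNorm_nonneg (pureState ψ - pureState φ)).eq_or_lt with h0 | h0
  · rw [← h0, div_zero]; linarith
  · rw [le_div_iff₀ h0]
    nlinarith

/-- Paths in `G` pass the projection untouched and contribute their full weight; every other path
contributes a nonnegative amount. -/
lemma le_re_trace_mul_noisyCircuit (h : IsKrausForm Φ K p) {D : ℕ} (G : Finset (Fin D → A))
    (U : Fin D → Matrix.unitaryGroup ι ℂ) (ψ : EuclideanSpace ℂ ι) {P : Matrix ι ι ℂ}
    (hP : P.IsHermitian) (hPP : P * P = P)
    (hG : ∀ α ∈ G, P *ᵥ (krausPath K D α U *ᵥ ψ) = krausPath K D α U *ᵥ ψ) :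
    ∑ α ∈ G, (krausPath K D α U * pureState ψ * (krausPath K D α U)ᴴ).trace.re ≤
      (P * noisyCircuit Φ D U (pureState ψ)).trace.re := by
  rw [noisyCircuit_eq_sum h, Matrix.mul_sum, trace_sum, Complex.re_sum]
  have hnn : ∀ α : Fin D → A, 0 ≤
      (P * (krausPath K D α U * pureState ψ * (krausPath K D α U)ᴴ)).trace.re := by
    intro α
    have h1 : (P * (krausPath K D α U * pureState ψ * (krausPath K D α U)ᴴ)).trace =
        ((P * krausPath K D α U) * pureState ψ * (P * krausPath K D α U)ᴴ).trace := by
      conv_lhs => rw [← hPP, Matrix.mul_assoc, trace_mul_comm]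
      rw [conjTranspose_mul, hP.eq]
      simp only [Matrix.mul_assoc]
    rw [h1]
    exact (Complex.le_def.mp
      ((posSemidef_pureState ψ).mul_mul_conjTranspose_same _).trace_nonneg).1
  refine le_trans (le_of_eq (Finset.sum_congr rfl fun α hα => ?_))
    (Finset.sum_le_univ_sum_of_nonneg hnn)
  congr 2
  rw [pureState_eq_vecMulVec, mul_vecMulVec, vecMulVec_mul, mul_vecMulVec, hG α hα]

lemma IsStateDesign.integrable_linear {ν : Measure (EuclideanSpace ℂ ι)}
    (hν : IsStateDesign 1 ν) (ℓ : Matrix ι ι ℂ →ₗ[ℂ] ℂ) :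
    Integrable (fun ψ => ℓ (pureState ψ)) ν := by
  obtain ⟨φ₀, μ, h0, hμ, rfl⟩ := hν
  have := hμ.isProbabilityMeasure
  have hc : Continuous fun ψ : EuclideanSpace ℂ ι => ℓ (pureState ψ) := by
    simp only [ℓ.eq_sum_matrix_single (pureState _)]
    exact continuous_finsetSum _ fun i _ => continuous_finsetSum _ fun j _ =>
      (continuous_pureState.matrix_elem i j).mul continuous_const
  rw [integrable_map_measure hc.aestronglyMeasurable
    (continuous_toEuclideanLin_apply φ₀).aemeasurable]
  exact (hc.comp (continuous_toEuclideanLin_apply φ₀)).integrable_of_compactSpace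

lemma measurable_contractionRatio (h : IsKrausForm Φ K p) (D : ℕ) :
    Measurable fun ω : EuclideanSpace ℂ ι × EuclideanSpace ℂ ι ×
      (Fin D → Matrix.unitaryGroup ι ℂ) =>
        contractionRatio (noisyCircuit Φ D ω.2.2) ω.1 ω.2.1 := by
  have c1 : Continuous fun ω : EuclideanSpace ℂ ι × EuclideanSpace ℂ ι ×
      (Fin D → Matrix.unitaryGroup ι ℂ) => pureState ω.1 :=
    continuous_pureState.comp continuous_fst
  have c2 : Continuous fun ω : EuclideanSpace ℂ ι × EuclideanSpace ℂ ι ×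
      (Fin D → Matrix.unitaryGroup ι ℂ) => pureState ω.2.1 :=
    continuous_pureState.comp (continuous_fst.comp continuous_snd)
  have c3 : Continuous fun ω : EuclideanSpace ℂ ι × EuclideanSpace ℂ ι ×
      (Fin D → Matrix.unitaryGroup ι ℂ) => ω.2.2 := continuous_snd.comp continuous_snd
  refine Measurable.div (measurable_traceNorm ?_ ?_) (measurable_traceNorm (c1.sub c2) ?_)
  · exact (continuous_noisyCircuit h D c3 c1).sub (continuous_noisyCircuit h D c3 c2)
  · exact fun ω => (posSemidef_noisyCircuit h D _ (posSemidef_pureState _)).1.sub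
      (posSemidef_noisyCircuit h D _ (posSemidef_pureState _)).1
  · exact fun ω => (posSemidef_pureState _).1.sub (posSemidef_pureState _).1

lemma abs_contractionRatio_noisyCircuit_le (h : IsKrausForm Φ K p)
    (htr : ∀ X, (Φ X).trace = X.trace) (D : ℕ) (U : Fin D → Matrix.unitaryGroup ι ℂ)
    (ψ φ : EuclideanSpace ℂ ι) : ‖contractionRatio (noisyCircuit Φ D U) ψ φ‖ ≤ 1 := by
  rw [Real.norm_of_nonneg (contractionRatio_nonneg _ _ _)]
  exact contractionRatio_le_one (fun X hX => posSemidef_noisyCircuit h D U hX)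
    (trace_noisyCircuit htr D U) ψ φ

lemma averageContraction_le_one (h : IsKrausForm Φ K p)
    (htr : ∀ X, (Φ X).trace = X.trace) (D : ℕ) {ν₁ ν₂ : Measure (EuclideanSpace ℂ ι)}
    {μ : Fin D → Measure (Matrix.unitaryGroup ι ℂ)} (hν₁ : IsStateDesign 1 ν₁)
    (hν₂ : IsStateDesign 1 ν₂) (hμ : ∀ k, IsUnitaryDesign 1 (μ k)) :
    averageContraction Φ D ν₁ ν₂ μ ≤ 1 := by
  have := hν₁.isProbabilityMeasure
  have := hν₂.isProbabilityMeasure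
  have := fun k => (hμ k).isProbabilityMeasure
  unfold averageContraction
  refine (le_abs_self _).trans ?_
  have := norm_integral_le_of_norm_le_const (μ := ν₁.prod (ν₂.prod (Measure.pi μ)))
    (ae_of_all _ fun ω => abs_contractionRatio_noisyCircuit_le h htr D ω.2.2 ω.1 ω.2.1)
  simpa using this

/-- Distinguishing the two outputs by the span of the Kraus paths in `G` gives a lower bound on
the average contraction. -/
lemma le_averageContraction (h : IsKrausForm Φ K p) (htr : ∀ X, (Φ X).trace = X.trace)
    (hu : IsUnital Φ) [Nonempty ι] {D : ℕ} (G : Finset (Fin D → A))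
    {ν₁ ν₂ : Measure (EuclideanSpace ℂ ι)} {μ : Fin D → Measure (Matrix.unitaryGroup ι ℂ)}
    (hν₁ : IsStateDesign 1 ν₁) (hν₂ : IsStateDesign 1 ν₂) (hμ : ∀ k, IsUnitaryDesign 1 (μ k)) :
    ∑ α ∈ G, ∏ k, p (α k) - G.card / Fintype.card ι ≤ averageContraction Φ D ν₁ ν₂ μ := by
  have := hν₁.isProbabilityMeasure
  have := hν₂.isProbabilityMeasure
  have := fun k => (hμ k).isProbabilityMeasure
  have hd : (Fintype.card ι : ℂ) ≠ 0 := by exact_mod_cast Fintype.card_ne_zero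
  have hmeas := measurable_contractionRatio h D
  have hbd := abs_contractionRatio_noisyCircuit_le h htr D
  have hpos := fun U X hX => posSemidef_noisyCircuit h D U (X := X) hX
  have hint : Integrable (fun ω : EuclideanSpace ℂ ι × EuclideanSpace ℂ ι ×
      (Fin D → Matrix.unitaryGroup ι ℂ) =>
        contractionRatio (noisyCircuit Φ D ω.2.2) ω.1 ω.2.1)
      (ν₁.prod (ν₂.prod (Measure.pi μ))) :=
    Integrable.of_bound hmeas.aestronglyMeasurable 1 (ae_of_all _ fun ω => hbd _ _ _)
  have hint₁ : ∀ ψ, Integrable (fun ω : EuclideanSpace ℂ ι ×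
      (Fin D → Matrix.unitaryGroup ι ℂ) => contractionRatio (noisyCircuit Φ D ω.2) ψ ω.1)
      (ν₂.prod (Measure.pi μ)) := fun ψ =>
    Integrable.of_bound (hmeas.comp measurable_prodMk_left).aestronglyMeasurable 1
      (ae_of_all _ fun ω => hbd _ _ _)
  have hint₂ : ∀ ψ U, Integrable (fun φ => contractionRatio (noisyCircuit Φ D U) ψ φ) ν₂ :=
    fun ψ U => Integrable.of_bound (hmeas.comp (measurable_prodMk_left.comp
      measurable_prodMk_right)).aestronglyMeasurable 1 (ae_of_all _ fun ω => hbd _ _ _)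
  have hinner : ∀ ψ : EuclideanSpace ℂ ι, ‖ψ‖ = 1 → ∀ U : Fin D → Matrix.unitaryGroup ι ℂ,
      ∑ α ∈ G, (krausPath K D α U * pureState ψ * (krausPath K D α U)ᴴ).trace.re -
        G.card / Fintype.card ι ≤ ∫ φ, contractionRatio (noisyCircuit Φ D U) ψ φ ∂ν₂ := by
    intro ψ hψ U
    -- `P` depends on `ψ` and the layers but not on `φ`, so it is constant in the integral over `φ`.
    -- Unitality then turns the average of the second term into `tr P / d`.
    obtain ⟨P, hP, hPP, hPv, hPt⟩ :=
      exists_projection_of_finset G fun α => krausPath K D α U *ᵥ ψ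
    let ℓ : Matrix ι ι ℂ →ₗ[ℂ] ℂ :=
      { toFun := fun Y => (P * noisyCircuit Φ D U Y).trace
        map_add' := fun Y Z => by simp [Matrix.mul_add]
        map_smul' := fun c Y => by simp }
    have hℓ := hν₂.integrable_linear ℓ
    have hℓi : Integrable (fun φ => (ℓ (pureState φ)).re) ν₂ := hℓ.re
    have hℓre : ∫ φ, (ℓ (pureState φ)).re ∂ν₂ = P.trace.re / Fintype.card ι := by
      have h1 := Complex.reCLM.integral_comp_comm hℓ
      simp only [Complex.reCLM_apply] at h1
      have h2 : ℓ 1 = P.trace := by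
        change (P * noisyCircuit Φ D U 1).trace = _
        rw [noisyCircuit_one hu, Matrix.mul_one]
      rw [h1, hν₂.integral_linear, h2, Complex.div_natCast_re]
    calc _ ≤ (P * noisyCircuit Φ D U (pureState ψ)).trace.re - P.trace.re / Fintype.card ι := by
          gcongr
          exact le_re_trace_mul_noisyCircuit h G U ψ hP hPP hPv
      _ = ∫ φ, ((P * noisyCircuit Φ D U (pureState ψ)).trace.re - (ℓ (pureState φ)).re) ∂ν₂ := by
          rw [integral_sub (integrable_const _) hℓi, hℓre]
          simp
      _ ≤ _ := by
          refine integral_mono_ae ((integrable_const _).sub hℓi) (hint₂ ψ U) ?_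
          filter_upwards [hν₂.ae_norm_eq_one] with φ hφ
          exact le_contractionRatio (hpos U) (trace_noisyCircuit htr D U) hψ hφ hP hPP
  have houter : ∀ ψ : EuclideanSpace ℂ ι, ‖ψ‖ = 1 →
      ∑ α ∈ G, ∏ k, p (α k) - G.card / Fintype.card ι ≤
        ∫ ω : EuclideanSpace ℂ ι × (Fin D → Matrix.unitaryGroup ι ℂ),
          contractionRatio (noisyCircuit Φ D ω.2) ψ ω.1 ∂(ν₂.prod (Measure.pi μ)) := by
    intro ψ hψ
    have hc : ∀ α : Fin D → A, Integrable (fun U =>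
        (krausPath K D α U * pureState ψ * (krausPath K D α U)ᴴ).trace) (Measure.pi μ) :=
      fun α => (((continuous_krausPath K _ α).matrix_mul continuous_const).matrix_mul
        (continuous_krausPath K _ α).matrix_conjTranspose).matrix_trace.integrable_of_compactSpace
    have hcre : ∀ α : Fin D → A, Integrable (fun U =>
        (krausPath K D α U * pureState ψ * (krausPath K D α U)ᴴ).trace.re) (Measure.pi μ) :=
      fun α => (hc α).re
    have hval : ∀ α : Fin D → A,
        ∫ U, (krausPath K D α U * pureState ψ * (krausPath K D α U)ᴴ).trace.re ∂(Measure.pi μ) =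
          ∏ k, p (α k) := by
      intro α
      have h1 := Complex.reCLM.integral_comp_comm (hc α)
      simp only [Complex.reCLM_apply] at h1
      rw [h1, integral_trace_krausPath h hd D μ hμ, trace_pureState, hψ, ← Complex.ofReal_mul,
        Complex.ofReal_re]
      ring
    -- The integral over `φ` must be innermost, with the layers fixed, because the projection varies
    -- with the layers.
    rw [integral_prod_symm _ (hint₁ ψ)]
    calc _ = ∫ U, (∑ α ∈ G, (krausPath K D α U * pureState ψ * (krausPath K D α U)ᴴ).trace.re -
          (G.card : ℝ) / Fintype.card ι) ∂(Measure.pi μ) := by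
          rw [integral_sub (integrable_finsetSum _ fun α _ => hcre α) (integrable_const _),
            integral_finsetSum _ fun α _ => hcre α, Finset.sum_congr rfl fun α _ => hval α]
          simp
      _ ≤ _ := integral_mono
          ((integrable_finsetSum _ fun α _ => hcre α).sub (integrable_const _))
          (hint₁ ψ).integral_prod_right (hinner ψ hψ)
  unfold averageContraction
  rw [integral_prod _ hint]
  calc _ = ∫ _ψ, (∑ α ∈ G, ∏ k, p (α k) - (G.card : ℝ) / Fintype.card ι) ∂ν₁ := by simp
    _ ≤ _ := by
      refine integral_mono_ae (integrable_const _) hint.integral_prod_left ?_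
      filter_upwards [hν₁.ae_norm_eq_one] with ψ hψ
      exact houter ψ hψ

end AverageContraction

/-! ### Kraus operators and their weights from the spectrum of the Choi state. -/

section Choi

variable {ι : Type} [Fintype ι] [DecidableEq ι]

lemma IsQuantumChannel.posSemidef_choiState {T : Matrix ι ι ℂ →ₗ[ℂ] Matrix ι ι ℂ}
    (hT : IsQuantumChannel T) : (choiState T).PosSemidef :=
  hT.completelyPositive ι _ (posSemidef_vecMulVec_self_star _)

/-- The canonical Kraus operators of a channel: the rescaled eigenvectors of its Choi state. -/
noncomputable def choiKraus {T : Matrix ι ι ℂ →ₗ[ℂ] Matrix ι ι ℂ}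
    (h : (choiState T).IsHermitian) (a : ι × ι) : Matrix ι ι ℂ :=
  Matrix.of fun i j => (√(Fintype.card ι * h.eigenvalues a) : ℂ) * h.eigenvectorBasis a (i, j)

lemma choiState_apply (T : Matrix ι ι ℂ →ₗ[ℂ] Matrix ι ι ℂ) (i j k l : ι) :
    choiState T (i, k) (j, l) = (Fintype.card ι : ℂ)⁻¹ * T (Matrix.single k l 1) i j := by
  have h1 : (Matrix.of fun i j : ι => vecMulVec (maxEntangled ι) (star (maxEntangled ι))
      (i, k) (j, l)) = (Fintype.card ι : ℂ)⁻¹ • Matrix.single k l 1 := by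
    ext i j
    have hs : ((√(Fintype.card ι : ℝ) : ℝ) : ℂ)⁻¹ * ((√(Fintype.card ι : ℝ) : ℝ) : ℂ)⁻¹ =
        (Fintype.card ι : ℂ)⁻¹ := by
      rw [← mul_inv, ← Complex.ofReal_mul, Real.mul_self_sqrt (Nat.cast_nonneg _)]
      simp
    simp only [of_apply, vecMulVec_apply, maxEntangled, Pi.star_apply, Matrix.smul_apply, single_apply,
      smul_eq_mul, eq_comm (a := k), eq_comm (a := l)]
    by_cases h1 : i = k <;> by_cases h2 : j = l <;> simp [h1, h2, hs]
  change T (Matrix.of fun i j : ι => vecMulVec (maxEntangled ι) (star (maxEntangled ι))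
      (i, k) (j, l)) i j = _
  rw [h1, map_smul]
  rfl

lemma Matrix.IsHermitian.apply_eq_sum_eigenvectorBasis {κ : Type} [Fintype κ] [DecidableEq κ]
    {M : Matrix κ κ ℂ} (h : M.IsHermitian) (x y : κ) :
    M x y = ∑ a, (h.eigenvalues a : ℂ) *
      (h.eigenvectorBasis a x * star (h.eigenvectorBasis a y)) := by
  conv_lhs => rw [h.eq_unitary_conj_diagonal]
  rw [mul_apply]
  refine Finset.sum_congr rfl fun a _ => ?_
  rw [mul_diagonal, conjTranspose_apply, IsHermitian.eigenvectorUnitary_apply,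
    IsHermitian.eigenvectorUnitary_apply]
  ring

lemma LinearMap.apply_eq_sum_single (T : Matrix ι ι ℂ →ₗ[ℂ] Matrix ι ι ℂ) (X : Matrix ι ι ℂ)
    (i j : ι) : T X i j = ∑ k, ∑ l, X k l * T (Matrix.single k l 1) i j :=
  LinearMap.eq_sum_matrix_single
    ({ toFun := fun Y => T Y i j
       map_add' := fun Y Z => by simp
       map_smul' := fun c Y => by simp } : Matrix ι ι ℂ →ₗ[ℂ] ℂ) X

omit [DecidableEq ι] in
lemma sum_mul_mul_conjTranspose_apply {A : Type} [Fintype A] (K : A → Matrix ι ι ℂ)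
    (X : Matrix ι ι ℂ) (i j : ι) : (∑ a, K a * X * (K a)ᴴ) i j =
      ∑ k, ∑ l, X k l * ∑ a, K a i k * star (K a j l) := by
  have h1 : ∀ a, (K a * X * (K a)ᴴ) i j = ∑ k, ∑ l, X k l * (K a i k * star (K a j l)) := by
    intro a
    simp only [mul_apply, conjTranspose_apply, Finset.sum_mul]
    rw [Finset.sum_comm]
    exact Finset.sum_congr rfl fun k _ => Finset.sum_congr rfl fun l _ => by ring
  rw [Matrix.sum_apply]
  simp only [h1, Finset.mul_sum]
  rw [Finset.sum_comm]
  exact Finset.sum_congr rfl fun k _ => Finset.sum_comm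

/-- Up to the factor `d` and a regrouping of indices, the Choi state is the matrix of `T`, so its
spectral decomposition is a Kraus decomposition. Since the eigenvectors are unit vectors, the
weights are the eigenvalues, and their Shannon entropy is `S(τ)`. -/
lemma IsQuantumChannel.isKrausForm [Nonempty ι] {T : Matrix ι ι ℂ →ₗ[ℂ] Matrix ι ι ℂ}
    (hT : IsQuantumChannel T) : IsKrausForm T (choiKraus hT.posSemidef_choiState.1)
      hT.posSemidef_choiState.1.eigenvalues := by
  have hd : (Fintype.card ι : ℂ) ≠ 0 := by exact_mod_cast Fintype.card_ne_zero
  have hP := hT.posSemidef_choiState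
  set h := hP.1
  have hsq : ∀ a, (√(Fintype.card ι * h.eigenvalues a) : ℂ) *
      (√(Fintype.card ι * h.eigenvalues a) : ℂ) = Fintype.card ι * h.eigenvalues a := by
    intro a
    rw [← Complex.ofReal_mul, Real.mul_self_sqrt
      (mul_nonneg (Nat.cast_nonneg _) (hP.eigenvalues_nonneg a))]
    simp
  have hKK : ∀ (a : ι × ι) (i j k l : ι), choiKraus h a i k * star (choiKraus h a j l) =
      Fintype.card ι * (h.eigenvalues a *
        (h.eigenvectorBasis a (i, k) * star (h.eigenvectorBasis a (j, l)))) := by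
    intro a i j k l
    simp only [choiKraus, of_apply, star_mul', Complex.star_def, Complex.conj_ofReal]
    linear_combination (h.eigenvectorBasis a (i, k) *
      (starRingEnd ℂ) (h.eigenvectorBasis a (j, l))) * hsq a
  constructor
  · intro X
    ext i j
    rw [sum_mul_mul_conjTranspose_apply, T.apply_eq_sum_single]
    refine Finset.sum_congr rfl fun k _ => Finset.sum_congr rfl fun l _ => ?_
    simp only [hKK]
    rw [← Finset.mul_sum, ← h.apply_eq_sum_eigenvectorBasis, choiState_apply,
      mul_inv_cancel_left₀ hd]
  · intro a
    have h1 : ∑ x, h.eigenvectorBasis a x * star (h.eigenvectorBasis a x) = 1 := by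
      have h2 := EuclideanSpace.norm_sq_eq (h.eigenvectorBasis a)
      rw [h.eigenvectorBasis.norm_eq_one, one_pow] at h2
      have h3 : ∀ x, h.eigenvectorBasis a x * star (h.eigenvectorBasis a x) =
          ((‖h.eigenvectorBasis a x‖ ^ 2 : ℝ) : ℂ) := fun x => by
        rw [Complex.star_def, Complex.mul_conj, Complex.normSq_eq_norm_sq]
      simp only [h3]
      rw [← Complex.ofReal_sum, ← h2, Complex.ofReal_one]
    simp only [Matrix.trace, diag, mul_apply, conjTranspose_apply, hKK]
    rw [← Fintype.sum_prod_type (fun x : ι × ι => (Fintype.card ι : ℂ) * (h.eigenvalues a *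
        (h.eigenvectorBasis a x * star (h.eigenvectorBasis a x)))), ← Finset.mul_sum,
      ← Finset.mul_sum, h1, mul_one]

lemma IsQuantumChannel.sum_eigenvalues_choiState [Nonempty ι]
    {T : Matrix ι ι ℂ →ₗ[ℂ] Matrix ι ι ℂ} (hT : IsQuantumChannel T) :
    ∑ a, hT.posSemidef_choiState.1.eigenvalues a = 1 := by
  have hd : (Fintype.card ι : ℂ) ≠ 0 := by exact_mod_cast Fintype.card_ne_zero
  have h1 := hT.posSemidef_choiState.1.trace_eq_sum_eigenvalues
  have h2 : (choiState T).trace = 1 := by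
    simp only [trace, diag]
    rw [Fintype.sum_prod_type, Finset.sum_comm]
    simp only [choiState_apply, ← Finset.mul_sum]
    have : ∀ k : ι, ∑ i, T (Matrix.single k k 1) i i = 1 := fun k => by
      have := hT.tracePreserving (Matrix.single k k 1)
      rwa [trace_single_eq_same] at this
    simp [this, hd]
  rw [h2] at h1
  rw [← Complex.ofReal_inj, Complex.ofReal_sum, Complex.ofReal_one]
  exact h1.symm

lemma vonNeumannEntropy_eq_shannonEntropy {κ : Type} [Fintype κ] [DecidableEq κ]
    {ρ : Matrix κ κ ℂ} (h : ρ.IsHermitian) :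
    vonNeumannEntropy ρ = shannonEntropy h.eigenvalues :=
  dif_pos h

end Choi

/-! ### Product channels: unitality, trace preservation and Kraus form. -/

section TensorPower

variable {φ : Matrix (Fin 2) (Fin 2) ℂ →ₗ[ℂ] Matrix (Fin 2) (Fin 2) ℂ}

lemma tensorPower_apply (n : ℕ) (M : Matrix (Qubits n) (Qubits n) ℂ) (a b : Qubits n) :
    tensorPower φ n M a b =
      ∑ i, ∑ j, M i j * ∏ s, φ (Matrix.single (i s) (j s) 1) (a s) (b s) := rfl

lemma prod_one_apply {n : ℕ} (a b : Qubits n) :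
    ∏ s, (1 : Matrix (Fin 2) (Fin 2) ℂ) (a s) (b s) = (1 : Matrix (Qubits n) (Qubits n) ℂ) a b := by
  simp only [Matrix.one_apply, Finset.prod_ite_zero, Finset.prod_const_one, Finset.mem_univ,
    forall_const, funext_iff]

lemma isUnital_tensorPower (hφ : IsUnital φ) (n : ℕ) : IsUnital (tensorPower φ n) := by
  ext a b
  rw [tensorPower_apply]
  have h0 : ∀ i j : Qubits n, (1 : Matrix (Qubits n) (Qubits n) ℂ) i j = if i = j then 1 else 0 :=
    fun i j => Matrix.one_apply
  simp only [h0, ite_mul, one_mul, zero_mul, Finset.sum_ite_eq,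
    Finset.mem_univ, if_true]
  rw [← Fintype.prod_sum (fun s (i : Fin 2) => φ (Matrix.single i i 1) (a s) (b s)),
    ← h0, ← prod_one_apply]
  refine Finset.prod_congr rfl fun s _ => ?_
  have h1 : φ 1 = 1 := hφ
  conv_rhs => rw [← h1, φ.apply_eq_sum_single]
  simp [Matrix.one_apply]

lemma trace_tensorPower (hφ : ∀ A, (φ A).trace = A.trace) (n : ℕ)
    (M : Matrix (Qubits n) (Qubits n) ℂ) : (tensorPower φ n M).trace = M.trace := by
  simp only [trace, diag, tensorPower_apply]
  rw [Finset.sum_comm]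
  refine Finset.sum_congr rfl fun i _ => ?_
  rw [Finset.sum_comm]
  simp only [← Finset.mul_sum]
  have h1 : ∀ j : Qubits n, ∑ a : Qubits n, ∏ s, φ (Matrix.single (i s) (j s) 1) (a s) (a s) =
      (1 : Matrix (Qubits n) (Qubits n) ℂ) i j := by
    intro j
    rw [← Fintype.prod_sum (fun s (x : Fin 2) => φ (Matrix.single (i s) (j s) 1) x x),
      ← prod_one_apply]
    refine Finset.prod_congr rfl fun s _ => ?_
    have := hφ (Matrix.single (i s) (j s) 1)
    simp only [trace, diag] at this
    rw [this]
    simp only [single_apply, Matrix.one_apply]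
    by_cases h : i s = j s
    · simp [h]
    · rw [if_neg h]
      exact Finset.sum_eq_zero fun x _ => if_neg fun hx => h (hx.1.trans hx.2.symm)
  simp only [h1]
  simp [Matrix.one_apply]

/-- The Kraus operators of `φ^{⊗ n}` are the tensor products of those of `φ`. -/
lemma IsKrausForm.tensorPower {A : Type} [Fintype A] {K : A → Matrix (Fin 2) (Fin 2) ℂ}
    {p : A → ℝ} (h : IsKrausForm φ K p) (n : ℕ) :
    IsKrausForm (_root_.tensorPower φ n)
      (fun a : Fin n → A => Matrix.of fun i j : Qubits n => ∏ s, K (a s) (i s) (j s))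
      (fun a => ∏ s, p (a s)) := by
  have hKK : ∀ x y i j : Fin 2,
      φ (Matrix.single i j 1) x y = ∑ a, K a x i * star (K a y j) := by
    intro x y i j
    rw [h.apply, sum_mul_mul_conjTranspose_apply]
    simp only [single_apply]
    rw [Finset.sum_eq_single i, Finset.sum_eq_single j] <;> simp +contextual [eq_comm]
  constructor
  · intro X
    ext x y
    rw [tensorPower_apply, sum_mul_mul_conjTranspose_apply]
    refine Finset.sum_congr rfl fun i _ => Finset.sum_congr rfl fun j _ => ?_
    simp only [hKK, of_apply, star_prod, ← Finset.prod_mul_distrib]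
    rw [Fintype.prod_sum (fun s a => K a (x s) (i s) * star (K a (y s) (j s)))]
  · intro a
    have h1 := fun s => h.trace (a s)
    simp only [Matrix.trace, diag, mul_apply, conjTranspose_apply] at h1
    simp only [Matrix.trace, diag, mul_apply, conjTranspose_apply, of_apply, star_prod,
      ← Finset.prod_mul_distrib]
    have h2 : ∀ x : Qubits n, ∑ y : Qubits n,
        ∏ s, K (a s) (x s) (y s) * star (K (a s) (x s) (y s)) =
        ∏ s, ∑ y, K (a s) (x s) y * star (K (a s) (x s) y) := fun x =>
      (Fintype.prod_sum (fun s y => K (a s) (x s) y * star (K (a s) (x s) y))).symm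
    simp only [h2]
    rw [← Fintype.prod_sum (fun s x => ∑ y, K (a s) x y * star (K (a s) x y))]
    simp only [h1, Finset.prod_mul_distrib]
    simp

end TensorPower

/-! ### Typical paths inserted into the lower bound. -/

section Main

/-- The depth bound for a general channel, from the asymptotic equipartition of its Kraus paths. -/
lemma le_averageContraction_of_varentropy {n : ℕ}
    {Φ : Matrix (Qubits n) (Qubits n) ℂ →ₗ[ℂ] Matrix (Qubits n) (Qubits n) ℂ}
    (hΦ : IsQuantumChannel Φ) (hu : IsUnital Φ) {D : ℕ} {t : ℝ} (ht : 0 < t)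
    {ν₁ ν₂ : Measure (EuclideanSpace ℂ (Qubits n))}
    {μ : Fin D → Measure (Matrix.unitaryGroup (Qubits n) ℂ)}
    (hν₁ : IsStateDesign 1 ν₁) (hν₂ : IsStateDesign 1 ν₂) (hμ : ∀ k, IsUnitaryDesign 1 (μ k)) :
    1 - D * varentropy hΦ.posSemidef_choiState.1.eigenvalues / t ^ 2 -
      (2 : ℝ) ^ (D * vonNeumannEntropy (choiState Φ) + t - n) ≤ averageContraction Φ D ν₁ ν₂ μ := by
  have hp := hΦ.posSemidef_choiState.eigenvalues_nonneg
  have hs := hΦ.sum_eigenvalues_choiState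
  have h1 := le_sum_typicalSet (J := Fin D) hp hs ht
  have h2 := card_typicalSet_le (J := Fin D) hp hs t
  have h3 := le_averageContraction hΦ.isKrausForm hΦ.tracePreserving hu
    (typicalSet (Fin D) hΦ.posSemidef_choiState.1.eigenvalues t) hν₁ hν₂ hμ
  rw [Fintype.card_fin] at h1 h2
  refine le_trans ?_ h3
  rw [vonNeumannEntropy_eq_shannonEntropy hΦ.posSemidef_choiState.1, Real.rpow_sub two_pos,
    Real.rpow_natCast]
  have hcard : (Fintype.card (Qubits n) : ℝ) = 2 ^ n := by simp
  rw [hcard]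
  gcongr

/-- The bound for a product channel, from the asymptotic equipartition over layers and qubits. -/
lemma le_averageContraction_tensorPower
    {φ : Matrix (Fin 2) (Fin 2) ℂ →ₗ[ℂ] Matrix (Fin 2) (Fin 2) ℂ}
    (hφ : IsQuantumChannel φ) (hu : IsUnital φ) {n D : ℕ} {t : ℝ} (ht : 0 < t)
    {ν₁ ν₂ : Measure (EuclideanSpace ℂ (Qubits n))}
    {μ : Fin D → Measure (Matrix.unitaryGroup (Qubits n) ℂ)}
    (hν₁ : IsStateDesign 1 ν₁) (hν₂ : IsStateDesign 1 ν₂) (hμ : ∀ k, IsUnitaryDesign 1 (μ k)) :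
    1 - D * n * varentropy hφ.posSemidef_choiState.1.eigenvalues / t ^ 2 -
      (2 : ℝ) ^ (D * n * vonNeumannEntropy (choiState φ) + t - n) ≤
        averageContraction (tensorPower φ n) D ν₁ ν₂ μ := by
  have hp := hφ.posSemidef_choiState.eigenvalues_nonneg
  have hs := hφ.sum_eigenvalues_choiState
  set p := hφ.posSemidef_choiState.1.eigenvalues
  have h1 := le_sum_typicalSet (J := Fin D × Fin n) hp hs ht
  have h2 := card_typicalSet_le (J := Fin D × Fin n) hp hs t
  -- A path picks one single-qubit Kraus operator per layer and qubit; currying identifies these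
  -- choices with sequences indexed by `Fin D × Fin n`.
  have h3 := le_averageContraction (hφ.isKrausForm.tensorPower n)
    (trace_tensorPower hφ.tracePreserving n) (isUnital_tensorPower hu n)
    ((typicalSet (Fin D × Fin n) p t).map (Equiv.curry (Fin D) (Fin n) _).toEmbedding) hν₁ hν₂ hμ
  rw [Finset.sum_map, Finset.card_map] at h3
  simp only [Fintype.card_prod, Fintype.card_fin, Nat.cast_mul, Fintype.prod_prod_type] at h1 h2
  refine le_trans ?_ h3
  rw [vonNeumannEntropy_eq_shannonEntropy hφ.posSemidef_choiState.1, Real.rpow_sub two_pos,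
    Real.rpow_natCast]
  have hcard : (Fintype.card (Qubits n) : ℝ) = 2 ^ n := by simp
  rw [hcard]
  exact sub_le_sub h1 (div_le_div_of_nonneg_right h2 (by positivity))

lemma tendsto_averageContraction_tensorPower
    {φ : Matrix (Fin 2) (Fin 2) ℂ →ₗ[ℂ] Matrix (Fin 2) (Fin 2) ℂ}
    (hφ : IsQuantumChannel φ) (hu : IsUnital φ) {D : ℕ}
    (hD : (D : ℝ) * vonNeumannEntropy (choiState φ) < 1)
    {ν₁ ν₂ : (n : ℕ) → Measure (EuclideanSpace ℂ (Qubits n))}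
    {μ : (n : ℕ) → Fin D → Measure (Matrix.unitaryGroup (Qubits n) ℂ)}
    (hν₁ : ∀ n, IsStateDesign 1 (ν₁ n)) (hν₂ : ∀ n, IsStateDesign 1 (ν₂ n))
    (hμ : ∀ n k, IsUnitaryDesign 1 (μ n k)) :
    Tendsto (fun n => averageContraction (tensorPower φ n) D (ν₁ n) (ν₂ n) (μ n))
      atTop (𝓝 1) := by
  set S := vonNeumannEntropy (choiState φ) with hS
  set V := varentropy hφ.posSemidef_choiState.1.eigenvalues
  -- `δ` is half the gap `1 - D S`. With tolerance `t = n δ` the Chebyshev error is of order `1 / n`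
  -- and the rank term decays geometrically in `n`.
  obtain ⟨δ, hδ, hδ'⟩ : ∃ δ : ℝ, 0 < δ ∧ D * S + δ - 1 < 0 :=
    ⟨(1 - D * S) / 2, by linarith, by linarith⟩
  have hlow : Tendsto (fun n : ℕ => 1 - D * V / δ ^ 2 * (n : ℝ)⁻¹ -
      ((2 : ℝ) ^ (D * S + δ - 1)) ^ n) atTop (𝓝 1) := by
    have h1 : Tendsto (fun n : ℕ => D * V / δ ^ 2 * (n : ℝ)⁻¹) atTop (𝓝 0) := by
      simpa using (tendsto_inv_atTop_nhds_zero_nat (𝕜 := ℝ)).const_mul (D * V / δ ^ 2)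
    have h2 : Tendsto (fun n : ℕ => ((2 : ℝ) ^ (D * S + δ - 1)) ^ n) atTop (𝓝 0) :=
      tendsto_pow_atTop_nhds_zero_of_lt_one (by positivity)
        (Real.rpow_lt_one_of_one_lt_of_neg one_lt_two hδ')
    simpa using (tendsto_const_nhds (x := (1 : ℝ))).sub h1 |>.sub h2
  -- The upper bound 1 is contractivity of channels. The lower bound needs `n > 0` so that the
  -- tolerance is positive.
  refine tendsto_of_tendsto_of_tendsto_of_le_of_le' hlow tendsto_const_nhds ?_ ?_
  · filter_upwards [eventually_gt_atTop 0] with n hn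
    have hn' : (0 : ℝ) < n := by exact_mod_cast hn
    have h := le_averageContraction_tensorPower hφ hu (mul_pos hn' hδ) (hν₁ n) (hν₂ n) (hμ n)
    refine le_trans (le_of_eq ?_) h
    congr 1
    · congr 1
      field_simp
      rfl
    · rw [← Real.rpow_natCast, ← Real.rpow_mul zero_le_two]
      congr 1
      rw [← hS]
      ring
  · exact Eventually.of_forall fun n =>
      averageContraction_le_one (hφ.isKrausForm.tensorPower n)
        (trace_tensorPower hφ.tracePreserving n) D (hν₁ n) (hν₂ n) (hμ n)

end Main

theorem mainTheorem4 :
    (∀ ε δ : ℝ, 0 < ε → ε < 1 → 0 < δ → ∀ K : ℕ, ∃ D₀ : ℕ,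
      ∀ (n : ℕ) (Φ : Matrix (Qubits n) (Qubits n) ℂ →ₗ[ℂ] Matrix (Qubits n) (Qubits n) ℂ),
        IsQuantumChannel Φ → IsUnital Φ → (choiState Φ).rank ≤ K →
        ∀ D : ℕ, D₀ ≤ D →
        ∀ (ν₁ ν₂ : Measure (EuclideanSpace ℂ (Qubits n)))
          (μ : Fin D → Measure (Matrix.unitaryGroup (Qubits n) ℂ)),
          IsStateDesign 1 ν₁ → IsStateDesign 1 ν₂ → (∀ k, IsUnitaryDesign 1 (μ k)) →
          1 - ε - (2 : ℝ) ^ ((D : ℝ) * (vonNeumannEntropy (choiState Φ) + δ) - (n : ℝ)) ≤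
            averageContraction Φ D ν₁ ν₂ μ) ∧
    (∀ φ : Matrix (Fin 2) (Fin 2) ℂ →ₗ[ℂ] Matrix (Fin 2) (Fin 2) ℂ,
      IsQuantumChannel φ → IsUnital φ →
      ∀ D : ℕ, (D : ℝ) * vonNeumannEntropy (choiState φ) < 1 →
      ∀ (ν₁ ν₂ : (n : ℕ) → Measure (EuclideanSpace ℂ (Qubits n)))
        (μ : (n : ℕ) → Fin D → Measure (Matrix.unitaryGroup (Qubits n) ℂ)),
        (∀ n, IsStateDesign 1 (ν₁ n)) → (∀ n, IsStateDesign 1 (ν₂ n)) →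
        (∀ n k, IsUnitaryDesign 1 (μ n k)) →
        Tendsto (fun n => averageContraction (tensorPower φ n) D (ν₁ n) (ν₂ n) (μ n))
          atTop (𝓝 1)) := by
  refine ⟨?_, fun φ hφ hu D hD ν₁ ν₂ μ hν₁ hν₂ hμ =>
    tendsto_averageContraction_tensorPower hφ hu hD hν₁ hν₂ hμ⟩
  intro ε δ hε _ hδ K
  set C : ℝ := K * (4 / Real.log 2 ^ 2) with hC
  -- With tolerance `t = D δ` the Chebyshev error is at most `D C / (D δ)² = C / (D δ²)`, which is
  -- below `ε` beyond this threshold. `C` bounds the varentropy through the Choi rank alone, hence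
  -- uniformly in `n`.
  obtain ⟨D₀, hD₀⟩ := exists_nat_gt (C / (ε * δ ^ 2))
  refine ⟨D₀ + 1, fun n Φ hΦ hu hK D hD ν₁ ν₂ μ hν₁ hν₂ hμ => ?_⟩
  have hD1 : (D₀ : ℝ) + 1 ≤ D := by exact_mod_cast hD
  have hD' : (0 : ℝ) < D := lt_of_lt_of_le (by positivity) hD1
  have h := le_averageContraction_of_varentropy hΦ hu (mul_pos hD' hδ) hν₁ hν₂ hμ
  have hV := varentropy_le hΦ.posSemidef_choiState.eigenvalues_nonneg
    hΦ.sum_eigenvalues_choiState (K := K)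
    (by rwa [← hΦ.posSemidef_choiState.1.rank_eq_card_non_zero_eigs])
  rw [← hC] at hV
  refine le_trans ?_ h
  rw [mul_add]
  gcongr
  rw [div_le_iff₀ (by positivity)]
  rw [div_lt_iff₀ (by positivity)] at hD₀
  have h1 : D₀ * (ε * δ ^ 2) ≤ D * (ε * δ ^ 2) := by gcongr; linarith
  calc _ ≤ D * (D * (ε * δ ^ 2)) := by gcongr; linarith
    _ = _ := by ring
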